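/- A \emph{bordered Riemann surface} is a compact connected Hausdorff space $\Sigma$ with an atlas of charts onto open subsets of $\mathbb{C}^+=\{z\in\mathbb{C}\mid \operatorname{Im}z\ge 0\}$ whose transition functions are holomorphic (i.e. are locally restrictions of holomorphic functions on open subsets of $\mathbb{C}$), and with nonempty boundary $\partial\Sigma$ (the points that charts map into $\mathbb{R}$). The components of $\partial\Sigma$ are circles, oriented so that (tangent vector, inner normal) is a positive basis for the complex orientation. A real subspace $V$ of an $n$-dimensional complex vector space is \emph{totally real} if $\dim_{\mathbb{R}}V=n$ and $V\cap iV=0$. Let $\mathcal{R}_n\cong GL(n,\mathbb{C})/GL(n,\mathbb{R})$ be the space of totally real subspaces of $\mathbb{C}^n$, and let $B(A\cdot\mathbb{R}^n)=A\bar A^{-1}$. The \emph{generalized Maslov index} of a loop $\gamma\colon S^1\to\mathcal{R}_n$ is $\mu(\gamma)=\deg(\det\circ B\circ\gamma\colon S^1\to U(1))$. Let $E$ be a complex vector bundle of rank $n$ over a bordered Riemann surface $\Sigma$, and let $E_{\mathbb{R}}$ be a totally real subbundle of $E|_{\partial\Sigma}$. Let $R_1,\dots,R_h$ be the connected components of $\partial\Sigma$,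 with the orientation above. For a trivialization $\Phi\colon E\cong\Sigma\times\mathbb{C}^n$ and an orientation-preserving homeomorphism $c_i\colon S^1\to R_i$, let $\mu(\Phi,R_i)$ be the generalized Maslov index of the loop $t\mapsto\Phi\big((E_{\mathbb{R}})_{c_i(t)}\big)$ in $\mathcal{R}_n$. \textbf{Proposition.} The sum $\sum_{i=1}^h\mu(\Phi,R_i)$ does not depend on the choice of the trivialization $\Phi$, nor on the parametrizations $c_i$: for any two trivializations $\Phi_1,\Phi_2$ of $E$ and any orientation-preserving parametrizations $c_i$ and $c_i'$ of the $R_i$, the sum computed with $\Phi_1$ and the $c_i$ equals the sum computed with $\Phi_2$ and the $c_i'$. Hence the Maslov index $\mu(E,E_{\mathbb{R}})=\sum_{i=1}^h\mu(\Phi,R_i)$ is well defined. -/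

import Mathlib

open Set Topology Bundle Matrix
open scoped Manifold ContDiff

noncomputable section

/-! ### Bordered Riemann surfaces -/

/-- The closed upper half plane `ℂ⁺ = {z ∈ ℂ | Im z ≥ 0}`. -/
def ClosedHalfPlane : Type := {z : ℂ // 0 ≤ z.im}

instance : TopologicalSpace ClosedHalfPlane := inferInstanceAs (TopologicalSpace {z : ℂ // 0 ≤ z.im})

namespace ClosedHalfPlane

/-- The inclusion `ℂ⁺ ⊆ ℂ`. -/
def toComplex (z : ClosedHalfPlane) : ℂ := z.1

theorem continuous_toComplex : Continuous toComplex := continuous_subtype_val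

/-- The retraction `x + iy ↦ x + i max(y, 0)` of `ℂ` onto `ℂ⁺`. -/
def proj (z : ℂ) : ClosedHalfPlane := ⟨⟨z.re, max z.im 0⟩, le_max_right _ _⟩

theorem continuous_proj : Continuous proj := by
  refine Continuous.subtype_mk ?_ _
  change Continuous fun z : ℂ => Complex.equivRealProdCLM.symm (z.re, max z.im 0)
  fun_prop

theorem proj_toComplex (z : ClosedHalfPlane) : proj z.toComplex = z :=
  Subtype.ext (Complex.ext rfl (max_eq_left z.2))

theorem toComplex_proj {z : ℂ} (hz : 0 ≤ z.im) : (proj z).toComplex = z :=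
  Complex.ext rfl (max_eq_left hz)

theorem range_toComplex : range toComplex = {z : ℂ | 0 ≤ z.im} :=
  Subtype.range_coe_subtype

end ClosedHalfPlane

open ClosedHalfPlane in
/-- The complex model with corners `ℂ⁺ ⊆ ℂ`.  With smoothness exponent `ω`, a transition function
between open subsets of `ℂ⁺` is admissible if near each point it is the restriction of a
holomorphic function defined on an open subset of `ℂ`. -/
def halfPlaneModel : ModelWithCorners ℂ ℂ ClosedHalfPlane where
  toFun := toComplex
  invFun := proj
  source := univ
  target := {z : ℂ | 0 ≤ z.im}
  map_source' z _ := z.2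
  map_target' _ _ := mem_univ _
  left_inv' z _ := proj_toComplex z
  right_inv' _ hz := toComplex_proj hz
  source_eq := rfl
  convex_range' := by
    have h : Convex ℝ (range toComplex) := by
      rw [range_toComplex]
      exact convex_halfSpace_im_ge 0
    rw [dif_pos (inferInstance : IsRCLikeNormedField ℂ)]
    exact Convex.convex_isRCLikeNormedField (𝕜 := ℂ) h
  nonempty_interior' := by
    change (interior (range toComplex)).Nonempty
    rw [range_toComplex]
    refine ⟨Complex.I, mem_interior.2 ⟨{z : ℂ | 0 < z.im}, fun z (hz : 0 < z.im) => hz.le, ?_, ?_⟩⟩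
    · exact isOpen_lt continuous_const Complex.continuous_im
    · simp
  continuous_toFun := continuous_toComplex
  continuous_invFun := continuous_proj

/-- The boundary `∂S` of a surface with charts in `ℂ⁺`: the points whose chart image is real. -/
abbrev surfaceBoundary (S : Type*) [TopologicalSpace S] [ChartedSpace ClosedHalfPlane S] : Set S :=
  halfPlaneModel.boundary S

theorem mem_surfaceBoundary_iff {S : Type*} [TopologicalSpace S] [ChartedSpace ClosedHalfPlane S]
    (x : S) : x ∈ surfaceBoundary S ↔ (chartAt ClosedHalfPlane x x).toComplex.im = 0 := by
  have h : range halfPlaneModel = {z : ℂ | 0 ≤ z.im} := ClosedHalfPlane.range_toComplex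
  change (chartAt ClosedHalfPlane x x).toComplex ∈ frontier (range halfPlaneModel) ↔ _
  rw [h, Complex.frontier_setOfPred_le_im]
  rfl

/-- A bordered Riemann surface: a compact connected Hausdorff space with a holomorphic atlas of
charts onto open subsets of `ℂ⁺` and with nonempty boundary. -/
class BorderedRiemannSurface (S : Type*) [TopologicalSpace S]
    [ChartedSpace ClosedHalfPlane S] : Prop where
  t2Space : T2Space S
  compactSpace : CompactSpace S
  connectedSpace : ConnectedSpace S
  isManifold : IsManifold halfPlaneModel ω S
  boundary_nonempty : (surfaceBoundary S).Nonempty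

/-- `c` is an orientation preserving parametrization of the boundary circle `R`: a continuous
bijection of the unit circle onto the connected component `R` of `∂S` along which, in every chart
with values in `ℂ⁺`, the real coordinate increases locally as the unit circle is traversed
counterclockwise.  (In such a chart the inner normal is `i` and `(1, i)` is a positive basis, so
this is the orientation for which (tangent vector, inner normal) is positive.) -/
structure IsOrientedBoundaryCircle {S : Type*} [TopologicalSpace S]
    [ChartedSpace ClosedHalfPlane S] (R : ConnectedComponents (surfaceBoundary S))
    (c : C(Circle, surfaceBoundary S)) : Prop where
  injective : Function.Injective c
  range_eq : range c = {x | ConnectedComponents.mk x = R}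
  positive : ∀ e ∈ atlas ClosedHalfPlane S, ∀ t : ℝ, (c (Circle.exp t) : S) ∈ e.source →
    ∃ N ∈ 𝓝 t, StrictMonoOn (fun s : ℝ => (e (c (Circle.exp s) : S)).toComplex.re) N

/-! ### The degree of a map between circles -/

theorem circleLift_exists (f : C(Circle, Circle)) :
    ∃ θ : C(ℝ, ℝ), ∀ t, f (Circle.exp t) = Circle.exp (θ t) := by
  obtain ⟨F, ⟨-, hF⟩, -⟩ := Circle.isCoveringMap_exp.existsUnique_continuousMap_lifts
    (f.comp Circle.exp) 0 (Complex.arg (f (Circle.exp 0))) (Circle.exp_arg _)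
  exact ⟨F, fun t => (congrFun hF t).symm⟩

theorem circleLift_degree_exists (f : C(Circle, Circle)) :
    ∃ k : ℤ, ∃ θ : C(ℝ, ℝ), (∀ t, f (Circle.exp t) = Circle.exp (θ t)) ∧
      ∀ t, θ (t + 2 * Real.pi) = θ t + k * (2 * Real.pi) := by
  obtain ⟨θ, hθ⟩ := circleLift_exists f
  have h2 : ∀ t, Circle.exp (θ (t + 2 * Real.pi)) = Circle.exp (θ t) := fun t => by
    rw [← hθ, ← hθ, Circle.exp_add_two_pi]
  obtain ⟨k, hk⟩ := Circle.exp_eq_exp.1 (h2 0)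
  refine ⟨k, θ, hθ, fun t => ?_⟩
  have key : (fun t => θ (t + 2 * Real.pi)) = fun t => θ t + k * (2 * Real.pi) := by
    refine Circle.isCoveringMap_exp.eq_of_comp_eq (by fun_prop) (by fun_prop) ?_ 0 (by simpa using hk)
    funext s
    exact (h2 s).trans (Circle.exp_eq_exp.2 ⟨-k, by push_cast; ring⟩)
  exact congrFun key t

/-- The degree of a continuous map `f : S¹ → S¹`: the integer `k` such that a continuous lift `θ`
of `f`, i.e. `f(e^{it}) = e^{iθ(t)}`, satisfies `θ(t + 2π) = θ(t) + 2πk`. -/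
def circleDegree (f : C(Circle, Circle)) : ℤ := (circleLift_degree_exists f).choose

theorem circleDegree_eq {f : C(Circle, Circle)} {k : ℤ} {θ : C(ℝ, ℝ)}
    (hθ : ∀ t, f (Circle.exp t) = Circle.exp (θ t))
    (hk : θ (2 * Real.pi) = θ 0 + k * (2 * Real.pi)) : circleDegree f = k := by
  obtain ⟨θ', hθ', hk'⟩ := (circleLift_degree_exists f).choose_spec
  obtain ⟨m, hm⟩ := Circle.exp_eq_exp.1 ((hθ 0).symm.trans (hθ' 0))
  have key : (θ : ℝ → ℝ) = fun t => θ' t + m * (2 * Real.pi) := by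
    refine Circle.isCoveringMap_exp.eq_of_comp_eq (by fun_prop) (by fun_prop) ?_ 0 hm
    funext s
    exact (hθ s).symm.trans ((hθ' s).trans (Circle.exp_eq_exp.2 ⟨-m, by push_cast; ring⟩))
  have h1 := congrFun key (2 * Real.pi)
  have h2 := hk' 0
  rw [zero_add] at h2
  have h3 : ((circleDegree f : ℤ) : ℝ) * (2 * Real.pi) = k * (2 * Real.pi) := by
    change (((circleLift_degree_exists f).choose : ℤ) : ℝ) * (2 * Real.pi) = _
    linarith
  exact_mod_cast mul_right_cancel₀ (by positivity) h3

/-! ### Totally real subspaces and the generalized Maslov index -/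

/-- A real subspace `V` of a complex vector space `W` is totally real if its real dimension is
`dim_ℂ W` and `V ∩ iV = 0`. -/
structure IsTotallyReal {W : Type*} [AddCommGroup W] [Module ℂ W] (V : Submodule ℝ W) : Prop where
  finrank_eq : Module.finrank ℝ V = Module.finrank ℂ W
  inter_eq : ∀ v ∈ V, Complex.I • v ∈ V → v = 0

/-- The space `𝓡_n` of totally real subspaces of `ℂⁿ`. -/
def TotallyRealSpace (n : ℕ) : Type :=
  {V : Submodule ℝ (Fin n → ℂ) // IsTotallyReal V}

/-- The inclusion `ℝⁿ ⊆ ℂⁿ`. -/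
def realInclusion (n : ℕ) : (Fin n → ℝ) →ₗ[ℝ] (Fin n → ℂ) where
  toFun x j := (x j : ℂ)
  map_add' x y := by ext j; simp
  map_smul' r x := by ext j; simp

/-- The real linear map `ℝⁿ → ℂⁿ`, `x ↦ A x`. -/
def realFrameMap {n : ℕ} (A : Matrix (Fin n) (Fin n) ℂ) : (Fin n → ℝ) →ₗ[ℝ] (Fin n → ℂ) :=
  (A.mulVecLin.restrictScalars ℝ).comp (realInclusion n)

theorem realFrameMap_apply {n : ℕ} (A : Matrix (Fin n) (Fin n) ℂ) (x : Fin n → ℝ) :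
    realFrameMap A x = A *ᵥ realInclusion n x := rfl

theorem GL_mulVec_injective {n : ℕ} (A : GL (Fin n) ℂ) :
    Function.Injective (fun v => A.1 *ᵥ v) :=
  Matrix.mulVec_injective_of_isUnit A.isUnit

theorem realFrameMap_injective {n : ℕ} (A : GL (Fin n) ℂ) :
    Function.Injective (realFrameMap A.1) := by
  intro x y h
  have h' := GL_mulVec_injective A h
  ext j
  simpa [realInclusion] using congrFun h' j

theorem isTotallyReal_range {n : ℕ} (A : GL (Fin n) ℂ) :
    IsTotallyReal (LinearMap.range (realFrameMap A.1)) where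
  finrank_eq := by
    rw [LinearMap.finrank_range_of_inj (realFrameMap_injective A)]
    simp
  inter_eq := by
    rintro _ ⟨x, rfl⟩ ⟨y, hy⟩
    rw [realFrameMap_apply, realFrameMap_apply, ← Matrix.mulVec_smul] at hy
    have h := GL_mulVec_injective A hy
    have hx : x = 0 := by
      ext j
      have := congrArg Complex.im (congrFun h j)
      simpa [realInclusion] using this.symm
    simp [hx]

/-- The totally real subspace `A · ℝⁿ` for `A ∈ GL(n, ℂ)`. -/
def TotallyRealSpace.ofGL {n : ℕ} (A : GL (Fin n) ℂ) : TotallyRealSpace n :=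
  ⟨LinearMap.range (realFrameMap A.1), isTotallyReal_range A⟩

/-- The topology of `𝓡_n ≅ GL(n, ℂ) / GL(n, ℝ)`: the quotient topology. -/
instance (n : ℕ) : TopologicalSpace (TotallyRealSpace n) :=
  TopologicalSpace.coinduced TotallyRealSpace.ofGL inferInstance

theorem IsTotallyReal.linearIndependent {W ι : Type*} [Fintype ι] [AddCommGroup W] [Module ℂ W]
    {V : Submodule ℝ W} (hV : IsTotallyReal V) {v : ι → W} (hv : LinearIndependent ℝ v)
    (hmem : ∀ j, v j ∈ V) : LinearIndependent ℂ v := by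
  rw [Fintype.linearIndependent_iff] at hv ⊢
  intro g hg
  have hsplit : (∑ j, (g j).re • v j) + Complex.I • (∑ j, (g j).im • v j) = 0 := by
    rw [← hg, Finset.smul_sum, ← Finset.sum_add_distrib]
    refine Finset.sum_congr rfl fun j _ => ?_
    conv_rhs => rw [← Complex.re_add_im (g j)]
    rw [add_smul, mul_comm, mul_smul]
    rfl
  have h1 : (∑ j, (g j).re • v j) ∈ V := V.sum_mem fun j _ => V.smul_mem _ (hmem j)
  have h2 : (∑ j, (g j).im • v j) ∈ V := V.sum_mem fun j _ => V.smul_mem _ (hmem j)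
  have h3 : (∑ j, (g j).im • v j) = 0 := by
    refine hV.inter_eq _ h2 ?_
    rw [← neg_eq_of_add_eq_zero_right hsplit]
    exact V.neg_mem h1
  rw [h3, smul_zero, add_zero] at hsplit
  intro j
  exact Complex.ext (hv _ hsplit j) (hv _ h3 j)

/-- The invertible matrix whose columns are the given linearly independent vectors. -/
def frameGL {n : ℕ} (v : Fin n → Fin n → ℂ) (hv : LinearIndependent ℂ v) : GL (Fin n) ℂ :=
  ((Matrix.linearIndependent_cols_iff_isUnit (A := (Matrix.of v)ᵀ)).1 hv).unit

theorem frameGL_val {n : ℕ} (v : Fin n → Fin n → ℂ) (hv : LinearIndependent ℂ v) :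
    (frameGL v hv).1 = (Matrix.of v)ᵀ := rfl

theorem range_realFrameMap_frame {n : ℕ} (v : Fin n → Fin n → ℂ) :
    LinearMap.range (realFrameMap (Matrix.of v)ᵀ) = Submodule.span ℝ (range v) := by
  have h : ∀ x, realFrameMap (Matrix.of v)ᵀ x = ∑ j, x j • v j := by
    intro x
    ext i
    simp [realFrameMap_apply, Matrix.mulVec, dotProduct, realInclusion, mul_comm]
  ext w
  rw [LinearMap.mem_range, Submodule.mem_span_range_iff_exists_fun]
  simp only [h]

/-- Every totally real subspace of `ℂⁿ` is of the form `A · ℝⁿ`. -/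
theorem TotallyRealSpace.ofGL_surjective (n : ℕ) :
    Function.Surjective (TotallyRealSpace.ofGL (n := n)) := by
  rintro ⟨V, hV⟩
  have hfin : Module.finrank ℝ V = n := by simpa using hV.finrank_eq
  let b := Module.finBasisOfFinrankEq ℝ V hfin
  let v : Fin n → Fin n → ℂ := fun j => (b j : Fin n → ℂ)
  have hv : LinearIndependent ℝ v := b.linearIndependent.map' V.subtype (Submodule.ker_subtype V)
  have hspan : Submodule.span ℝ (range v) = V := by
    have : range v = V.subtype '' range b := by
      rw [← range_comp]; rfl
    rw [this, Submodule.span_image, b.span_eq, Submodule.map_top, Submodule.range_subtype]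
  refine ⟨frameGL v (hV.linearIndependent hv fun j => (b j).2), Subtype.ext ?_⟩
  exact (range_realFrameMap_frame v).trans hspan

/-- The entrywise complex conjugate `Ā` of `A ∈ GL(n, ℂ)`. -/
def conjGL {n : ℕ} : GL (Fin n) ℂ →* GL (Fin n) ℂ :=
  Matrix.GeneralLinearGroup.map (starRingEnd ℂ)

/-- The map `B : 𝓡_n → GL(n, ℂ)`, `B(A · ℝⁿ) = A Ā⁻¹`. -/
def TotallyRealSpace.B {n : ℕ} (V : TotallyRealSpace n) : GL (Fin n) ℂ :=
  (ofGL_surjective n V).choose * (conjGL (ofGL_surjective n V).choose)⁻¹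

theorem TotallyRealSpace.conj_quotient_eq {n : ℕ} {A A' : GL (Fin n) ℂ}
    (h : ofGL A = ofGL A') : A * (conjGL A)⁻¹ = A' * (conjGL A')⁻¹ := by
  have hr : LinearMap.range (realFrameMap A.1) = LinearMap.range (realFrameMap A'.1) :=
    congrArg Subtype.val h
  have hx : ∀ j : Fin n, ∃ x, realFrameMap A.1 x = realFrameMap A'.1 (Pi.single j 1) := fun j => by
    rw [← LinearMap.mem_range, hr]
    exact LinearMap.mem_range_self _ _
  choose x hx using hx
  let M : Matrix (Fin n) (Fin n) ℂ := Matrix.of fun i j => ((x j i : ℝ) : ℂ)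
  have hM : A.1 * M = A'.1 := by
    ext i j
    have h1 := congrFun (hx j) i
    have h2 : realInclusion n (Pi.single j 1) = Pi.single j (1 : ℂ) := by
      ext k
      by_cases hk : k = j
      · subst hk; simp [realInclusion]
      · simp [realInclusion, hk]
    rw [realFrameMap_apply, realFrameMap_apply, h2, Matrix.mulVec_single_one] at h1
    exact h1
  have hG : (A⁻¹ * A').1 = M := by
    rw [Units.val_mul, ← hM, ← Matrix.mul_assoc, ← Units.val_mul, inv_mul_cancel, Units.val_one,
      Matrix.one_mul]
  have hc : conjGL (A⁻¹ * A') = A⁻¹ * A' := by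
    apply Units.ext
    change (A⁻¹ * A').1.map (starRingEnd ℂ) = _
    rw [hG]
    ext i j
    simp [M]
  rw [map_mul, map_inv] at hc
  have hc' : conjGL A' = conjGL A * (A⁻¹ * A') := by rw [← hc]; group
  rw [hc']
  group

theorem TotallyRealSpace.B_ofGL {n : ℕ} (A : GL (Fin n) ℂ) :
    B (ofGL A) = A * (conjGL A)⁻¹ :=
  conj_quotient_eq (ofGL_surjective n (ofGL A)).choose_spec

theorem TotallyRealSpace.det_B_ofGL {n : ℕ} (A : GL (Fin n) ℂ) :
    (B (ofGL A)).1.det = A.1.det / (starRingEnd ℂ) A.1.det := by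
  rw [B_ofGL, Units.val_mul, Matrix.det_mul, Matrix.coe_units_inv, Matrix.det_nonsing_inv,
    Ring.inverse_eq_inv', div_eq_mul_inv, RingHom.map_det]
  rfl

theorem TotallyRealSpace.norm_det_B {n : ℕ} (V : TotallyRealSpace n) : ‖(B V).1.det‖ = 1 := by
  obtain ⟨A, rfl⟩ := ofGL_surjective n V
  have h : A.1.det ≠ 0 := (Matrix.isUnit_iff_isUnit_det _).1 A.isUnit |>.ne_zero
  rw [det_B_ofGL, norm_div, RCLike.norm_conj, div_self (norm_ne_zero_iff.2 h)]

/-- The continuous map `det ∘ B : 𝓡_n → U(1)`. -/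
def TotallyRealSpace.detB (n : ℕ) : C(TotallyRealSpace n, Circle) where
  toFun V := ⟨(B V).1.det, show (B V).1.det ∈ Metric.sphere (0 : ℂ) 1 from
    mem_sphere_zero_iff_norm.2 (norm_det_B V)⟩
  continuous_toFun := by
    refine continuous_coinduced_dom.2 ?_
    refine Continuous.subtype_mk (f := fun A => (B (ofGL A)).1.det) ?_ _
    simp only [det_B_ofGL]
    refine Continuous.div ?_ ?_ fun A => ?_
    · exact Units.continuous_val.matrix_det
    · exact Complex.continuous_conj.comp Units.continuous_val.matrix_det
    · have h : A.1.det ≠ 0 := (Matrix.isUnit_iff_isUnit_det _).1 A.isUnit |>.ne_zero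
      exact (map_ne_zero _).2 h

/-- The (generalized) Maslov index `μ(γ) = deg(det ∘ B ∘ γ)` of a loop `γ : S¹ → 𝓡_n`. -/
def maslovIndex {n : ℕ} (γ : C(Circle, TotallyRealSpace n)) : ℤ :=
  circleDegree ((TotallyRealSpace.detB n).comp γ)

/-! ### Totally real subbundles -/

/-- A totally real subbundle `E_ℝ` of `E|_K`, for a complex vector bundle `E` of rank `n` over `S`
and a subset `K` of `S`: a totally real subspace `(E_ℝ)_x` of `E_x` for each `x ∈ K`, such that
locally on `K` there are `n` continuous sections of `E` forming a real basis of `(E_ℝ)_x`. -/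
structure TotallyRealSubbundle {S : Type*} [TopologicalSpace S] (n : ℕ) (E : S → Type*)
    [TopologicalSpace (TotalSpace (Fin n → ℂ) E)] [∀ x, AddCommGroup (E x)] [∀ x, Module ℂ (E x)]
    (K : Set S) where
  /-- The fibre `(E_ℝ)_x`. -/
  fiber : ∀ x : K, Submodule ℝ (E x)
  isTotallyReal : ∀ x, IsTotallyReal (fiber x)
  exists_frame : ∀ x₀ : K, ∃ U ∈ 𝓝 x₀, ∃ s : Fin n → ∀ x : K, E x,
    (∀ j, ContinuousOn (fun x : K => (⟨x, s j x⟩ : TotalSpace (Fin n → ℂ) E)) U) ∧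
    ∀ x ∈ U, LinearIndependent ℝ (fun j => s j x) ∧
      Submodule.span ℝ (range fun j => s j x) = fiber x

section Trivialization

variable {S : Type*} [TopologicalSpace S] {n : ℕ} {E : S → Type*}
  [TopologicalSpace (TotalSpace (Fin n → ℂ) E)] [∀ x, AddCommGroup (E x)] [∀ x, Module ℂ (E x)]

/-- A (global, continuous, fibrewise complex linear) trivialization `Φ : E ≅ S × ℂⁿ`. -/
structure GlobalTrivialization (S : Type*) [TopologicalSpace S] (n : ℕ) (E : S → Type*)
    [TopologicalSpace (TotalSpace (Fin n → ℂ) E)] [∀ x, AddCommGroup (E x)]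
    [∀ x, Module ℂ (E x)] where
  /-- The homeomorphism from the total space of `E` to `S × ℂⁿ`. -/
  toHomeomorph : TotalSpace (Fin n → ℂ) E ≃ₜ S × (Fin n → ℂ)
  /-- The linear isomorphism `Φ_x : E_x ≅ ℂⁿ`. -/
  fiberEquiv : ∀ x, E x ≃ₗ[ℂ] (Fin n → ℂ)
  apply_eq : ∀ x (v : E x), toHomeomorph ⟨x, v⟩ = (x, fiberEquiv x v)

/-- The totally real subspace `Φ((E_ℝ)_x) ⊆ ℂⁿ`. -/
def TotallyRealSubbundle.image {K : Set S} (ER : TotallyRealSubbundle n E K)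
    (Φ : GlobalTrivialization S n E) (x : K) : TotallyRealSpace n :=
  ⟨(ER.fiber x).map ((Φ.fiberEquiv x).toLinearMap.restrictScalars ℝ), by
    constructor
    · rw [← (Φ.fiberEquiv x).finrank_eq, ← (ER.isTotallyReal x).finrank_eq]
      exact ((Φ.fiberEquiv x).restrictScalars ℝ).finrank_map_eq _
    · rintro _ ⟨v, hv, rfl⟩ ⟨w, hw, h⟩
      have h' : w = Complex.I • v := (Φ.fiberEquiv x).injective (by simpa using h)
      rw [(ER.isTotallyReal x).inter_eq v hv (h' ▸ hw), map_zero]⟩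

theorem TotallyRealSubbundle.continuous_image {K : Set S} (ER : TotallyRealSubbundle n E K)
    (Φ : GlobalTrivialization S n E) : Continuous (ER.image Φ) := by
  rw [continuous_iff_continuousAt]
  intro x₀
  obtain ⟨U, hU, s, hs, hU'⟩ := ER.exists_frame x₀
  let v : K → Fin n → Fin n → ℂ := fun x j => Φ.fiberEquiv x (s j x)
  have hv : ∀ j, ContinuousOn (fun x => v x j) U := fun j => by
    have h := (continuous_snd.comp Φ.toHomeomorph.continuous).comp_continuousOn (hs j)
    refine h.congr fun x _ => ?_
    simp [v, Φ.apply_eq]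
  have hli : ∀ x ∈ U, LinearIndependent ℂ (v x) := fun x hx => by
    have h := (ER.isTotallyReal x).linearIndependent (hU' x hx).1 fun j => by
      rw [← (hU' x hx).2]
      exact Submodule.subset_span ⟨j, rfl⟩
    exact h.map' (Φ.fiberEquiv x).toLinearMap (Φ.fiberEquiv x).ker
  let A : U → GL (Fin n) ℂ := fun x => frameGL (v x) (hli x x.2)
  have hAval : Continuous fun x => (A x).1 := by
    refine continuous_pi fun i => continuous_pi fun j => ?_
    exact (continuous_apply i).comp ((hv j).domRestrict)
  have hA : Continuous A := by
    rw [Units.continuous_iff]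
    refine ⟨hAval, ?_⟩
    have : (fun x => ((A x)⁻¹).1) = fun x => (A x).1⁻¹ := by
      funext x; exact Matrix.coe_units_inv _
    change Continuous fun x => ((A x)⁻¹).1
    rw [this]
    simp only [Matrix.inv_def]
    have hd : ∀ x, (A x).1.det ≠ 0 := fun x =>
      ((Matrix.isUnit_iff_isUnit_det _).1 (A x).isUnit).ne_zero
    simp only [Ring.inverse_eq_inv']
    exact (hAval.matrix_det.inv₀ hd).smul hAval.matrix_adjugate
  have hof : Continuous (TotallyRealSpace.ofGL (n := n)) := continuous_coinduced_rng
  have heq : U.domRestrict (ER.image Φ) = fun x => TotallyRealSpace.ofGL (A x) := by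
    funext x
    refine Subtype.ext ?_
    change (ER.fiber x).map _ = LinearMap.range (realFrameMap (Matrix.of (v x))ᵀ)
    rw [range_realFrameMap_frame, ← (hU' x x.2).2, Submodule.map_span, ← range_comp]
    rfl
  have hres : ContinuousOn (ER.image Φ) U := by
    rw [continuousOn_iff_continuous_domRestrict, heq]
    exact hof.comp hA
  exact hres.continuousAt hU

/-- The loop `t ↦ Φ((E_ℝ)_{c(t)})` of totally real subspaces of `ℂⁿ` obtained from `E_ℝ`, the
trivialization `Φ` and a loop `c` in `K`. -/
def TotallyRealSubbundle.loop {K : Set S} (ER : TotallyRealSubbundle n E K)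
    (Φ : GlobalTrivialization S n E) (c : C(Circle, K)) : C(Circle, TotallyRealSpace n) :=
  (⟨ER.image Φ, ER.continuous_image Φ⟩ : C(K, TotallyRealSpace n)).comp c

end Trivialization

end

/-!
Two trivializations `Φ₁`, `Φ₂` of `E` differ by a continuous map `A : S → GL(n, ℂ)`, and `det ∘ B`
of the loops of `E_ℝ` read in `Φ₂` and in `Φ₁` differ by the factor `f = det A / conj (det A)`
(`TotallyRealSubbundle.detB_image`).  Since degrees are additive, the two sums of Maslov indices
differ by the sum of the degrees of `f` on the oriented boundary circles.  As `f : S → U(1)` is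
defined on all of `S`, this sum vanishes (`sum_circleDegree_boundary_eq_zero`).  Changing an
oriented parametrization amounts to precomposing with an increasing reparametrization of the
circle, which has degree one (`circleDegree_comp_orientedBoundaryCircle`).

The vanishing is Stokes' theorem for the closed form `df / f`, after `f` has been replaced by a
smooth map `S → ℂ \ {0}` close to it, which does not change the degrees.  Stokes' theorem is proved
with a finite smooth partition of unity `uᵢ` subordinate to charts:

* in the chart of `uᵢ`, Green's theorem on the half plane (`green_upperHalf`) turns the integral of
  `d (uᵢ df / f) = duᵢ ∧ df / f` into the boundary integral of `uᵢ df / f`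
  (`setIntegral_wedgeDlog`);
* the integrals of `duᵢ ∧ df / f` add up to zero because `∑ duᵢ = d 1 = 0`; comparing the different
  charts takes the change of variables formula and the fact that transition functions are
  holomorphic, so that their Jacobian is `|φ'|² ≥ 0` (`sum_setIntegral_wedgeDlog`);
* the boundary integrals of the `uᵢ df / f` add up to `2πi` times the sum of the degrees.  Boundary
  parametrizations are only continuous, so the boundary integral is not pulled back to the circle.
  It is regarded as an additive function of closed subsets of the surface (`boundaryIntegral`),
  which on a short arc is the increment of `log f`, by a computation in a single chart
  (`eventually_boundaryIntegral_circleArc`).  Transition functions of charts in the half plane have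
  nonnegative real derivative along the boundary (`coordDeriv_boundary`), so this does not depend on
  the chart.
-/

noncomputable section

open MeasureTheory

/-! ### The half plane and smooth functions in charts -/

/-- The closed upper half plane as a subset of `ℂ`. -/
def upperHalf : Set ℂ := {z : ℂ | 0 ≤ z.im}

theorem range_halfPlaneModel : range halfPlaneModel = upperHalf :=
  ClosedHalfPlane.range_toComplex

theorem isClosed_upperHalf : IsClosed upperHalf :=
  isClosed_le continuous_const Complex.continuous_im

theorem interior_upperHalf : interior upperHalf = {z : ℂ | 0 < z.im} :=
  Complex.interior_setOfPred_le_im 0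

theorem convex_upperHalf : Convex ℝ upperHalf := convex_halfSpace_im_ge 0

theorem uniqueDiffOn_upperHalf : UniqueDiffOn ℝ upperHalf :=
  uniqueDiffOn_convex convex_upperHalf (by
    rw [interior_upperHalf]
    exact ⟨Complex.I, by simp⟩)

theorem upperHalf_mem_nhds {z : ℂ} (hz : 0 < z.im) : upperHalf ∈ 𝓝 z := by
  rw [← mem_interior_iff_mem_nhds, interior_upperHalf]
  exact hz

theorem ofReal_mem_upperHalf (x : ℝ) : (x : ℂ) ∈ upperHalf := by
  simp [upperHalf]

/-- The half plane `ℂ⁺`, as a real model with corners.  It has the same underlying map as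
`halfPlaneModel`, so that the charts of a surface are the same for both; smooth partitions of unity
are available over this one. -/
def realHalfPlaneModel : ModelWithCorners ℝ ℂ ClosedHalfPlane :=
  ModelWithCorners.ofConvexRange halfPlaneModel.toPartialEquiv rfl
    convex_upperHalf halfPlaneModel.continuous_toFun halfPlaneModel.continuous_invFun
    (by
      change (interior upperHalf).Nonempty
      rw [interior_upperHalf]
      exact ⟨Complex.I, by simp⟩)

section Chart

variable {S : Type*} [TopologicalSpace S] [ChartedSpace ClosedHalfPlane S]

/-- A holomorphic atlas is a smooth atlas. -/
theorem isManifold_realHalfPlaneModel [IsManifold halfPlaneModel ω S] :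
    IsManifold realHalfPlaneModel ∞ S := by
  refine isManifold_of_contDiffOn _ _ _ fun e e' he he' => ?_
  have h : ContDiffOn ℂ ω _ _ := ((contDiffGroupoid ω halfPlaneModel).compatible he he').1
  exact (h.restrict_scalars ℝ).of_le le_top

/-- The preferred chart at `p`, as a partial map to `ℂ`. -/
def coord (p : S) : PartialEquiv S ℂ := extChartAt halfPlaneModel p

theorem coord_source (p : S) : (coord p).source = (chartAt ClosedHalfPlane p).source :=
  extChartAt_source _ p

theorem isOpen_coord_source (p : S) : IsOpen (coord p).source := isOpen_extChartAt_source p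

theorem coord_target_subset (p : S) : (coord p).target ⊆ upperHalf := by
  rw [← range_halfPlaneModel]
  exact extChartAt_target_subset_range p

theorem coord_target_mem_nhdsWithin {p : S} {z : ℂ} (hz : z ∈ (coord p).target) :
    (coord p).target ∈ 𝓝[upperHalf] z := by
  rw [← range_halfPlaneModel]
  exact extChartAt_target_mem_nhdsWithin_of_mem hz

theorem continuousOn_coord_symm (p : S) : ContinuousOn (coord p).symm (coord p).target :=
  continuousOn_extChartAt_symm p

theorem continuousWithinAt_coord_symm {p : S} {z : ℂ} (hz : z ∈ (coord p).target) :
    ContinuousWithinAt (coord p).symm upperHalf z :=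
  (continuousOn_coord_symm p z hz).mono_of_mem_nhdsWithin (coord_target_mem_nhdsWithin hz)

theorem coord_symm_preimage_mem_nhdsWithin {p : S} {z : ℂ} (hz : z ∈ (coord p).target)
    {U : Set S} (hU : IsOpen U) (hzU : (coord p).symm z ∈ U) :
    (coord p).target ∩ (coord p).symm ⁻¹' U ∈ 𝓝[upperHalf] z :=
  Filter.inter_mem (coord_target_mem_nhdsWithin hz)
    ((continuousWithinAt_coord_symm hz).preimage_mem_nhdsWithin (hU.mem_nhds hzU))

/-- The part of the image of a chart over an open subset of the surface is Borel. -/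
theorem measurableSet_coord_preimage (p : S) {U : Set S} (hU : IsOpen U) :
    MeasurableSet ((coord p).target ∩ (coord p).symm ⁻¹' U) := by
  have : ∀ z ∈ (coord p).target ∩ (coord p).symm ⁻¹' U, ∃ V, IsOpen V ∧ z ∈ V ∧
      V ∩ upperHalf ⊆ (coord p).target ∩ (coord p).symm ⁻¹' U := fun z hz => by
    obtain ⟨V, hV, hzV, h⟩ := mem_nhdsWithin.1 (coord_symm_preimage_mem_nhdsWithin hz.1 hU hz.2)
    exact ⟨V, hV, hzV, h⟩
  choose! V hV hzV hVs using this
  have h : (coord p).target ∩ (coord p).symm ⁻¹' U =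
      (⋃ z ∈ (coord p).target ∩ (coord p).symm ⁻¹' U, V z) ∩ upperHalf := by
    apply Subset.antisymm
    · exact fun z hz => ⟨mem_biUnion hz (hzV z hz), coord_target_subset p hz.1⟩
    · rintro w ⟨hw, hwH⟩
      obtain ⟨z, hz, hwz⟩ := mem_iUnion₂.1 hw
      exact hVs z hz ⟨hwz, hwH⟩
  rw [h]
  exact (isOpen_biUnion fun z hz => hV z hz).measurableSet.inter isClosed_upperHalf.measurableSet

theorem measurableSet_coord_target (p : S) : MeasurableSet (coord p).target := by
  simpa using measurableSet_coord_preimage p isOpen_univ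

/-- The derivative of the change of coordinates from the chart at `p` to the chart at `q`. -/
def coordDeriv (p q : S) (z : ℂ) : ℂ :=
  derivWithin (coord q ∘ (coord p).symm) upperHalf z

theorem hasDerivWithinAt_coordChange [IsManifold halfPlaneModel ω S] {p q : S} {z : ℂ}
    (hz : z ∈ (coord p).target) (hzq : (coord p).symm z ∈ (coord q).source) :
    HasDerivWithinAt (coord q ∘ (coord p).symm) (coordDeriv p q z) upperHalf z := by
  have h := contDiffWithinAt_ext_coord_change (I := halfPlaneModel) (n := ω) q p (y := z)
    ⟨hz, hzq⟩
  rw [range_halfPlaneModel] at h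
  exact (h.differentiableWithinAt (by simp)).hasDerivWithinAt

theorem hasFDerivWithinAt_coordChange [IsManifold halfPlaneModel ω S] {p q : S} {z : ℂ}
    (hz : z ∈ (coord p).target) (hzq : (coord p).symm z ∈ (coord q).source) :
    HasFDerivWithinAt (coord q ∘ (coord p).symm)
      (((ContinuousLinearMap.toSpanSingleton ℂ (coordDeriv p q z)).restrictScalars ℝ))
        upperHalf z :=
  (hasDerivWithinAt_coordChange hz hzq).hasFDerivWithinAt.restrictScalars ℝ

theorem det_toSpanSingleton_restrictScalars (a : ℂ) :
    ((ContinuousLinearMap.toSpanSingleton ℂ a).restrictScalars ℝ).det = Complex.normSq a := by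
  rw [ContinuousLinearMap.det, ← LinearMap.det_toMatrix Complex.basisOneI, Matrix.det_fin_two]
  simp [LinearMap.toMatrix_apply, Complex.normSq_apply]

/-- A point of a chart lies on the boundary exactly if its coordinate is real. -/
theorem mem_surfaceBoundary_iff_coord_im [IsManifold halfPlaneModel ω S] {p x : S}
    (hx : x ∈ (coord p).source) : x ∈ surfaceBoundary S ↔ (coord p x).im = 0 := by
  have hx' : x ∈ (chartAt ClosedHalfPlane p).source := by
    rwa [coord_source] at hx
  have h := ModelWithCorners.isInteriorPoint_iff_of_mem_atlas (I := halfPlaneModel) (n := ω)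
    (by simp) (chart_mem_atlas ClosedHalfPlane p) hx'
  have h2 : (chartAt ClosedHalfPlane p).extend halfPlaneModel x ∈
      interior ((chartAt ClosedHalfPlane p).extend halfPlaneModel).target ↔
      0 < (coord p x).im := by
    refine ⟨fun h => ?_, fun h => ?_⟩
    · have h' := OpenPartialHomeomorph.interior_extend_target_subset_interior_range _ h
      rw [range_halfPlaneModel, interior_upperHalf] at h'
      exact h'
    · refine (chartAt ClosedHalfPlane p).mem_interior_extend_target
        ((chartAt ClosedHalfPlane p).map_source hx') ?_
      rw [range_halfPlaneModel, interior_upperHalf]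
      exact h
  change halfPlaneModel.IsBoundaryPoint x ↔ _
  rw [ModelWithCorners.isBoundaryPoint_iff_not_isInteriorPoint, h, h2, not_lt]
  exact ⟨fun h => le_antisymm h (coord_target_subset p ((coord p).map_source hx)), fun h => h.le⟩

theorem mem_surfaceBoundary_iff_im [IsManifold halfPlaneModel ω S] {p : S} {z : ℂ}
    (hz : z ∈ (coord p).target) : (coord p).symm z ∈ surfaceBoundary S ↔ z.im = 0 := by
  rw [mem_surfaceBoundary_iff_coord_im ((coord p).map_target hz), (coord p).right_inv hz]

/-- The expression of a function on the surface in the chart at `p`. -/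
def inCoord (p : S) (g : S → ℂ) : ℂ → ℂ := g ∘ (coord p).symm

/-- The (one-sided, at the boundary) real derivative of a function in the chart at `p`. -/
def coordFDeriv (p : S) (g : S → ℂ) (z : ℂ) : ℂ →L[ℝ] ℂ :=
  fderivWithin ℝ (inCoord p g) upperHalf z

/-- A smooth complex function on the surface, for the underlying real structure. -/
abbrev SmoothOnSurface (g : S → ℂ) : Prop := ContMDiff realHalfPlaneModel 𝓘(ℝ, ℂ) ∞ g

theorem SmoothOnSurface.contDiffOn_inCoord [IsManifold halfPlaneModel ω S] {g : S → ℂ}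
    (hg : SmoothOnSurface g) (p : S) : ContDiffOn ℝ ∞ (inCoord p g) (coord p).target := by
  have := isManifold_realHalfPlaneModel (S := S)
  exact (hg.comp_contMDiffOn (contMDiffOn_extChartAt_symm (I := realHalfPlaneModel) p)).contDiffOn

theorem SmoothOnSurface.contDiffWithinAt_inCoord [IsManifold halfPlaneModel ω S] {g : S → ℂ}
    (hg : SmoothOnSurface g) {p : S} {z : ℂ} (hz : z ∈ (coord p).target) :
    ContDiffWithinAt ℝ ∞ (inCoord p g) upperHalf z :=
  (hg.contDiffOn_inCoord p z hz).mono_of_mem_nhdsWithin (coord_target_mem_nhdsWithin hz)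

theorem SmoothOnSurface.hasFDerivWithinAt_inCoord [IsManifold halfPlaneModel ω S] {g : S → ℂ}
    (hg : SmoothOnSurface g) {p : S} {z : ℂ} (hz : z ∈ (coord p).target) :
    HasFDerivWithinAt (inCoord p g) (coordFDeriv p g z) upperHalf z :=
  ((hg.contDiffWithinAt_inCoord hz).differentiableWithinAt (by simp)).hasFDerivWithinAt

theorem SmoothOnSurface.contDiffWithinAt_coordFDeriv [IsManifold halfPlaneModel ω S] {g : S → ℂ}
    (hg : SmoothOnSurface g) {p : S} {z : ℂ} (hz : z ∈ (coord p).target) :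
    ContDiffWithinAt ℝ ∞ (coordFDeriv p g) upperHalf z :=
  (hg.contDiffWithinAt_inCoord hz).fderivWithin_right uniqueDiffOn_upperHalf (by simp)
    (coord_target_subset p hz)

/-- The chain rule for a change of coordinates. -/
theorem SmoothOnSurface.coordFDeriv_apply [IsManifold halfPlaneModel ω S] {g : S → ℂ}
    (hg : SmoothOnSurface g) {p q : S} {z : ℂ} (hz : z ∈ (coord p).target)
    (hzq : (coord p).symm z ∈ (coord q).source) (v : ℂ) :
    coordFDeriv p g z v = coordFDeriv q g (coord q ((coord p).symm z)) (v * coordDeriv p q z) := by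
  have h1 := hasFDerivWithinAt_coordChange hz hzq
  have h2 := hg.hasFDerivWithinAt_inCoord ((coord q).map_source hzq)
  set O := (coord p).target ∩ (coord p).symm ⁻¹' (coord q).source
  have hO : O ∈ 𝓝[upperHalf] z :=
    coord_symm_preimage_mem_nhdsWithin hz (isOpen_coord_source q) hzq
  have hmaps : MapsTo (coord q ∘ (coord p).symm) O upperHalf := fun w hw =>
    coord_target_subset q ((coord q).map_source hw.2)
  have h3 := h2.comp z (h1.mono_of_mem_nhdsWithin
    (Filter.mem_of_superset self_mem_nhdsWithin
      (inter_subset_left.trans (coord_target_subset p)))) hmaps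
  have h4 := (h3.congr (f₁ := inCoord p g) (fun w hw => by
    simp only [inCoord, Function.comp_apply]
    rw [(coord q).left_inv hw.2]) (by
    simp only [inCoord, Function.comp_apply]
    rw [(coord q).left_inv hzq])).mono_of_mem_nhdsWithin hO
  rw [coordFDeriv, h4.fderivWithin (uniqueDiffOn_upperHalf z (coord_target_subset p hz))]
  simp

end Chart

/-! ### Green's theorem on the half plane -/

/-- Green's theorem on the half plane, for compactly supported coefficients. -/
theorem green_upperHalf {P Q : ℂ → ℂ} (hP : ContDiffOn ℝ 1 P upperHalf)
    (hQ : ContDiffOn ℝ 1 Q upperHalf) {r : ℝ} (hPr : ∀ z, r < ‖z‖ → P z = 0)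
    (hQr : ∀ z, r < ‖z‖ → Q z = 0) :
    ∫ z in upperHalf, (fderivWithin ℝ Q upperHalf z 1 - fderivWithin ℝ P upperHalf z Complex.I) =
      ∫ x : ℝ, P x := by
  set R : ℝ := max r 0 + 1
  have hrR : r < R := (le_max_left r 0).trans_lt (lt_add_one _)
  have hR : 0 < R := by positivity
  set φ : ℝ × ℝ →L[ℝ] ℂ := (Complex.equivRealProdCLM.symm : ℝ × ℝ →L[ℝ] ℂ)
  have hφ : ∀ x : ℝ × ℝ, φ x = ⟨x.1, x.2⟩ := fun x => rfl
  have hφre : ∀ x : ℝ × ℝ, (φ x).re = x.1 := fun x => rfl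
  have hφim : ∀ x : ℝ × ℝ, (φ x).im = x.2 := fun x => rfl
  have hφ1 : φ (1, 0) = 1 := by apply Complex.ext <;> simp [hφ]
  have hφI : φ (0, 1) = Complex.I := by apply Complex.ext <;> simp [hφ]
  set G : ℂ → ℂ := fun z =>
    fderivWithin ℝ Q upperHalf z 1 - fderivWithin ℝ P upperHalf z Complex.I
  -- the integrand vanishes far away
  have hzero : ∀ A : ℂ → ℂ, (∀ z, r < ‖z‖ → A z = 0) → ∀ z, r < ‖z‖ →
      fderivWithin ℝ A upperHalf z = 0 := fun A hA z hz => by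
    have : A =ᶠ[𝓝[upperHalf] z] fun _ => 0 := by
      filter_upwards [mem_nhdsWithin_of_mem_nhds
        ((isOpen_lt continuous_const continuous_norm).mem_nhds hz)] with w hw using hA w hw
    rw [this.fderivWithin_eq (hA z hz)]
    simp
  have hGr : ∀ z, r < ‖z‖ → G z = 0 := fun z hz => by
    simp only [G, hzero P hPr z hz, hzero Q hQr z hz]
    simp
  set box : Set (ℝ × ℝ) := Icc (-R, 0) (R, R)
  have hbox : ∀ x ∈ box, φ x ∈ upperHalf := fun x hx => by
    change 0 ≤ (φ x).im
    rw [hφim]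
    exact hx.1.2
  have hout : ∀ x : ℝ × ℝ, R ≤ |x.1| ∨ R ≤ |x.2| → r < ‖φ x‖ := by
    rintro x (hx | hx)
    · exact hrR.trans_le (hx.trans (by rw [← hφre]; exact Complex.abs_re_le_norm _))
    · exact hrR.trans_le (hx.trans (by rw [← hφim]; exact Complex.abs_im_le_norm _))
  have hint : ∫ z in upperHalf, G z = ∫ x in box, G (φ x) := by
    have h1 := Complex.volume_preserving_equiv_real_prod.symm.setIntegral_preimage_emb
      Complex.measurableEquivRealProd.symm.measurableEmbedding G upperHalf
    rw [← h1]
    change ∫ x in φ ⁻¹' upperHalf, G (φ x) = _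
    refine setIntegral_eq_of_subset_of_forall_sdiff_eq_zero (f := fun x => G (φ x)) ?_ hbox ?_
    · exact (isClosed_upperHalf.preimage φ.continuous).measurableSet
    · rintro x ⟨hx, hxb⟩
      have hx2 : 0 ≤ x.2 := hx
      refine hGr _ (hout x ?_)
      by_contra! hcon
      exact hxb ⟨⟨(abs_lt.1 hcon.1).1.le, hx2⟩, ⟨(abs_lt.1 hcon.1).2.le, (abs_lt.1 hcon.2).2.le⟩⟩
  have hcont : ∀ A : ℂ → ℂ, ContDiffOn ℝ 1 A upperHalf → ∀ v, ContinuousOn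
      (fun x => fderivWithin ℝ A upperHalf (φ x) v) box := fun A hA v =>
    ((hA.continuousOn_fderivWithin uniqueDiffOn_upperHalf le_rfl).clm_apply
      continuousOn_const).comp φ.continuous.continuousOn hbox
  have hder : ∀ A : ℂ → ℂ, ContDiffOn ℝ 1 A upperHalf → ∀ x ∈ Ioo (-R) R ×ˢ Ioo 0 R,
      HasFDerivAt (fun x => A (φ x)) ((fderivWithin ℝ A upperHalf (φ x)).comp φ) x :=
    fun A hA x hx => by
      have hpos : 0 < (φ x).im := hx.2.1
      have h := ((hA.differentiableOn one_ne_zero (φ x) hpos.le).hasFDerivWithinAt.hasFDerivAt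
        (upperHalf_mem_nhds hpos))
      exact h.comp x φ.hasFDerivAt
  have key := integral_divergence_prod_Icc_of_hasFDerivAt_of_le
    (fun x => Q (φ x)) (fun x => -P (φ x))
    (fun x => (fderivWithin ℝ Q upperHalf (φ x)).comp φ)
    (fun x => -(fderivWithin ℝ P upperHalf (φ x)).comp φ) (-R, 0) (R, R)
    ⟨by simp; linarith, hR.le⟩
    (hQ.continuousOn.comp φ.continuous.continuousOn hbox)
    ((hP.continuousOn.comp φ.continuous.continuousOn hbox).neg)
    (fun x hx => hder Q hQ x hx) (fun x hx => (hder P hP x hx).neg)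
    (by
      simp only [ContinuousLinearMap.comp_apply, hφ1, hφI, _root_.neg_apply]
      exact ((hcont Q hQ 1).add (hcont P hP Complex.I).neg).integrableOn_compact isCompact_Icc)
  simp only [ContinuousLinearMap.comp_apply, hφ1, hφI, _root_.neg_apply] at key
  have e1 : ∀ x, P (φ (x, R)) = 0 := fun x =>
    hPr _ (hout _ (Or.inr (le_abs_self R)))
  have e2 : ∀ y, Q (φ (R, y)) = 0 := fun y => hQr _ (hout _ (Or.inl (le_abs_self R)))
  have e3 : ∀ y, Q (φ (-R, y)) = 0 := fun y =>
    hQr _ (hout _ (Or.inl (by rw [abs_neg]; exact le_abs_self R)))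
  have e4 : ∀ x : ℝ, φ (x, 0) = x := fun x => rfl
  simp only [e1, e2, e3, e4, neg_zero, intervalIntegral.integral_zero, zero_sub, add_zero,
    sub_zero, intervalIntegral.integral_neg, neg_neg] at key
  rw [hint]
  simp only [G, sub_eq_add_neg]
  rw [key, intervalIntegral.integral_of_le (by linarith)]
  refine setIntegral_eq_integral_of_forall_compl_eq_zero fun x hx => ?_
  have h5 : R ≤ |x| := by
    by_contra! hcon
    exact hx ⟨(abs_lt.1 hcon).1, (abs_lt.1 hcon).2.le⟩
  exact hPr _ (by simpa [e4] using hout (x, 0) (Or.inl h5))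

/-! ### Compactly supported functions and the form `u df / f` in a chart -/

section Chart

variable {S : Type*} [TopologicalSpace S] [ChartedSpace ClosedHalfPlane S]

theorem eventually_indicator_coord_eq_zero {p : S} {K : Set S} (hK : IsCompact K)
    (hKp : K ⊆ (coord p).source) {g : ℂ → ℂ}
    (h0 : ∀ z ∈ (coord p).target, (coord p).symm z ∉ K → g z = 0) {z : ℂ}
    (hz : z ∉ (coord p).target) : ∀ᶠ w in 𝓝 z, (coord p).target.indicator g w = 0 := by
  have hKc : IsClosed (coord p '' K) :=
    (hK.image_of_continuousOn ((continuousOn_extChartAt p).mono hKp)).isClosed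
  have hzK : z ∉ coord p '' K := by
    rintro ⟨x, hx, rfl⟩
    exact hz ((coord p).map_source (hKp hx))
  filter_upwards [hKc.isOpen_compl.mem_nhds hzK] with w hw
  by_cases hwt : w ∈ (coord p).target
  · rw [indicator_of_mem hwt]
    exact h0 w hwt fun h => hw ⟨_, h, (coord p).right_inv hwt⟩
  · exact indicator_of_notMem hwt _

/-- A smooth function on a chart which vanishes off a compact set extends by zero to a smooth
function on the half plane. -/
theorem contDiffOn_indicator_coord {p : S} {K : Set S} (hK : IsCompact K)
    (hKp : K ⊆ (coord p).source) {g : ℂ → ℂ} {m : WithTop ℕ∞}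
    (hg : ∀ z ∈ (coord p).target, ContDiffWithinAt ℝ m g upperHalf z)
    (h0 : ∀ z ∈ (coord p).target, (coord p).symm z ∉ K → g z = 0) :
    ContDiffOn ℝ m ((coord p).target.indicator g) upperHalf := by
  intro z hz
  by_cases hzt : z ∈ (coord p).target
  · refine (hg z hzt).congr_of_eventuallyEq ?_ (indicator_of_mem hzt _)
    filter_upwards [coord_target_mem_nhdsWithin hzt] with w hw using indicator_of_mem hw _
  · refine (contDiffWithinAt_const (c := (0 : ℂ))).congr_of_eventuallyEq ?_
      (indicator_of_notMem hzt _)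
    exact nhdsWithin_le_nhds (eventually_indicator_coord_eq_zero hK hKp h0 hzt)

theorem exists_indicator_coord_eq_zero {p : S} {K : Set S} (hK : IsCompact K)
    (hKp : K ⊆ (coord p).source) : ∃ r : ℝ, ∀ g : ℂ → ℂ,
    (∀ z ∈ (coord p).target, (coord p).symm z ∉ K → g z = 0) →
    ∀ z, r < ‖z‖ → (coord p).target.indicator g z = 0 := by
  obtain ⟨r, hr⟩ := (hK.image_of_continuousOn
    ((continuousOn_extChartAt (I := halfPlaneModel) p).mono hKp)).isBounded.exists_norm_le
  refine ⟨r, fun g h0 z hz => ?_⟩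
  by_cases hzt : z ∈ (coord p).target
  · rw [indicator_of_mem hzt]
    exact h0 z hzt fun h => (hr z ⟨_, h, (coord p).right_inv hzt⟩).not_gt hz
  · exact indicator_of_notMem hzt _

/-- A continuous function on a chart which vanishes off a compact set is integrable. -/
theorem integrableOn_coord_target {p : S} {K : Set S} (hK : IsCompact K)
    (hKp : K ⊆ (coord p).source) {g : ℂ → ℂ} (hg : ContinuousOn g (coord p).target)
    (h0 : ∀ z ∈ (coord p).target, (coord p).symm z ∉ K → g z = 0) :
    IntegrableOn g (coord p).target := by
  have hKc := hK.image_of_continuousOn ((continuousOn_extChartAt (I := halfPlaneModel) p).mono hKp)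
  have hsub : coord p '' K ⊆ (coord p).target := by
    rintro _ ⟨x, hx, rfl⟩
    exact (coord p).map_source (hKp hx)
  refine ((hg.mono hsub).integrableOn_compact hKc).of_forall_sdiff_eq_zero
    (measurableSet_coord_target p) fun z hz => ?_
  exact h0 z hz.1 fun h => hz.2 ⟨_, h, (coord p).right_inv hz.1⟩

/-- The coefficient of `du ∧ df / f` with respect to `dx ∧ dy` in the chart at `p`. -/
def wedgeDlog (p : S) (u f : S → ℂ) (z : ℂ) : ℂ :=
  (coordFDeriv p u z 1 * coordFDeriv p f z Complex.I -
    coordFDeriv p u z Complex.I * coordFDeriv p f z 1) / inCoord p f z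

/-- The value of `u df / f` on the tangent vector `v` in the chart at `p`. -/
def smulDlog (p : S) (u f : S → ℂ) (v z : ℂ) : ℂ :=
  inCoord p u z * coordFDeriv p f z v / inCoord p f z

theorem contDiffWithinAt_smulDlog [IsManifold halfPlaneModel ω S]
    {u f : S → ℂ} (hu : SmoothOnSurface u) (hf : SmoothOnSurface f)
    (hf0 : ∀ x, f x ≠ 0) (p : S) (v : ℂ) {z : ℂ} (hz : z ∈ (coord p).target) :
    ContDiffWithinAt ℝ ∞ (smulDlog p u f v) upperHalf z := by
  have h1 := hu.contDiffWithinAt_inCoord hz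
  have h2 := (hf.contDiffWithinAt_coordFDeriv hz).clm_apply (contDiffWithinAt_const (c := v))
  have h3 := hf.contDiffWithinAt_inCoord hz
  exact (h1.mul h2).mul (h3.inv (hf0 _))

/-- `d (u df / f) = du ∧ df / f`: the second derivatives of `f` cancel by symmetry. -/
theorem fderivWithin_smulDlog_sub [IsManifold halfPlaneModel ω S]
    {u f : S → ℂ} (hu : SmoothOnSurface u) (hf : SmoothOnSurface f)
    (hf0 : ∀ x, f x ≠ 0) (p : S) {z : ℂ} (hz : z ∈ (coord p).target) :
    fderivWithin ℝ (smulDlog p u f Complex.I) upperHalf z 1 -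
      fderivWithin ℝ (smulDlog p u f 1) upperHalf z Complex.I = wedgeDlog p u f z := by
  have hzH := coord_target_subset p hz
  have hud := uniqueDiffOn_upperHalf z hzH
  have key : ∀ v w, fderivWithin ℝ (smulDlog p u f v) upperHalf z w =
      coordFDeriv p u z w * coordFDeriv p f z v / inCoord p f z +
      inCoord p u z * fderivWithin ℝ (coordFDeriv p f) upperHalf z w v / inCoord p f z -
      inCoord p u z * coordFDeriv p f z v * coordFDeriv p f z w / inCoord p f z ^ 2 := by
    intro v w
    have h1 := hu.hasFDerivWithinAt_inCoord hz
    have h2 := (((hf.contDiffWithinAt_coordFDeriv hz).differentiableWithinAt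
      (by simp)).hasFDerivWithinAt.clm_apply (hasFDerivWithinAt_const v z upperHalf))
    have h3 := hf.hasFDerivWithinAt_inCoord hz
    have h4 := (h1.mul h2).mul
      (((hasDerivAt_inv (hf0 _)).hasFDerivAt.restrictScalars ℝ).comp_hasFDerivWithinAt z h3)
    have h5 : HasFDerivWithinAt (smulDlog p u f v) _ upperHalf z := h4
    rw [h5.fderivWithin hud]
    have := hf0 ((coord p).symm z)
    simp [inCoord]
    field_simp
    ring
  have hsymm : IsSymmSndFDerivWithinAt ℝ (inCoord p f) upperHalf z :=
    (hf.contDiffWithinAt_inCoord hz).isSymmSndFDerivWithinAt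
      (by simpa using (WithTop.coe_le_coe.2 le_top : ((2 : ℕ∞) : WithTop ℕ∞) ≤ ∞))
      uniqueDiffOn_upperHalf (by
        rw [convex_upperHalf.closure_interior_eq_closure_of_nonempty_interior
          (by rw [interior_upperHalf]; exact ⟨Complex.I, by simp⟩)]
        exact subset_closure hzH) hzH
  have hs := hsymm 1 Complex.I
  change fderivWithin ℝ (coordFDeriv p f) upperHalf z 1 Complex.I =
    fderivWithin ℝ (coordFDeriv p f) upperHalf z Complex.I 1 at hs
  rw [key, key, hs, wedgeDlog]
  ring

end Chart

/-! ### Stokes' theorem with a partition of unity -/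

section Chart

variable {S : Type*} [TopologicalSpace S] [ChartedSpace ClosedHalfPlane S]

theorem coordFDeriv_eq_zero {p : S} {u : S → ℂ} {z : ℂ} (hz : z ∈ (coord p).target)
    (hu0 : (coord p).symm z ∉ tsupport u) : coordFDeriv p u z = 0 := by
  have h : inCoord p u =ᶠ[𝓝[upperHalf] z] fun _ => 0 := by
    filter_upwards [coord_symm_preimage_mem_nhdsWithin hz (isClosed_tsupport u).isOpen_compl hu0]
      with w hw using image_eq_zero_of_notMem_tsupport (f := u) hw.2
  rw [coordFDeriv, h.fderivWithin_eq (h.self_of_nhdsWithin (coord_target_subset p hz))]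
  simp

/-- Stokes' theorem in one chart, for the form `u df / f` with `u` supported in the chart. -/
theorem setIntegral_wedgeDlog [IsManifold halfPlaneModel ω S]
    {p : S} {u f : S → ℂ} (hu : SmoothOnSurface u)
    (hf : SmoothOnSurface f) (hf0 : ∀ x, f x ≠ 0) (huc : IsCompact (tsupport u))
    (hup : tsupport u ⊆ (coord p).source) :
    ∫ z in (coord p).target, wedgeDlog p u f z =
      ∫ x : ℝ, (coord p).target.indicator (smulDlog p u f 1) x := by
  have h0 : ∀ v, ∀ z ∈ (coord p).target, (coord p).symm z ∉ tsupport u →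
      smulDlog p u f v z = 0 := fun v z _ hzu => by
    simp [smulDlog, inCoord, image_eq_zero_of_notMem_tsupport hzu]
  have hsm : ∀ v, ContDiffOn ℝ 1 ((coord p).target.indicator (smulDlog p u f v)) upperHalf :=
    fun v => contDiffOn_indicator_coord huc hup
      (fun z hz => (contDiffWithinAt_smulDlog hu hf hf0 p v hz).of_le (by simp)) (h0 v)
  obtain ⟨r, hr⟩ := exists_indicator_coord_eq_zero huc hup
  rw [← green_upperHalf (hsm 1) (hsm Complex.I) (hr _ (h0 _)) (hr _ (h0 _))]
  have h1 : ∀ z ∈ (coord p).target, ∀ v,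
      fderivWithin ℝ ((coord p).target.indicator (smulDlog p u f v)) upperHalf z =
        fderivWithin ℝ (smulDlog p u f v) upperHalf z := fun z hz v => by
    refine Filter.EventuallyEq.fderivWithin_eq ?_ (indicator_of_mem hz _)
    filter_upwards [coord_target_mem_nhdsWithin hz] with w hw using indicator_of_mem hw _
  have h2 : ∀ z ∉ (coord p).target, ∀ v,
      fderivWithin ℝ ((coord p).target.indicator (smulDlog p u f v)) upperHalf z = 0 :=
    fun z hz v => by
      have h : (coord p).target.indicator (smulDlog p u f v) =ᶠ[𝓝[upperHalf] z] fun _ => 0 :=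
        nhdsWithin_le_nhds (eventually_indicator_coord_eq_zero huc hup (h0 v) hz)
      rw [h.fderivWithin_eq (indicator_of_notMem hz _)]
      simp
  rw [setIntegral_eq_of_subset_of_forall_sdiff_eq_zero isClosed_upperHalf.measurableSet
    (coord_target_subset p) (fun z hz => by simp [h2 z hz.2])]
  refine setIntegral_congr_fun (measurableSet_coord_target p) fun z hz => ?_
  simp only [h1 z hz]
  exact (fderivWithin_smulDlog_sub hu hf hf0 p hz).symm

/-- The form `du ∧ df / f` does not depend on the chart. -/
theorem wedgeDlog_coordChange [IsManifold halfPlaneModel ω S]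
    {u f : S → ℂ} (hu : SmoothOnSurface u) (hf : SmoothOnSurface f)
    {p q : S} {z : ℂ} (hz : z ∈ (coord p).target) (hzq : (coord p).symm z ∈ (coord q).source) :
    wedgeDlog p u f z =
      Complex.normSq (coordDeriv p q z) • wedgeDlog q u f (coord q ((coord p).symm z)) := by
  have hlin : ∀ (L : ℂ →L[ℝ] ℂ) (v : ℂ), L v = v.re * L 1 + v.im • L Complex.I := fun L v => by
    conv_lhs => rw [← Complex.re_add_im v]
    have h : (v.re : ℂ) + v.im * Complex.I = v.re • (1 : ℂ) + v.im • Complex.I := by simp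
    rw [h, map_add, map_smul, map_smul, Complex.real_smul]
  have hF : inCoord q f (coord q ((coord p).symm z)) = inCoord p f z := by
    simp only [inCoord, Function.comp_apply]
    rw [(coord q).left_inv hzq]
  simp only [wedgeDlog, hu.coordFDeriv_apply hz hzq, hf.coordFDeriv_apply hz hzq, hF]
  set a := coordDeriv p q z
  set w := coord q ((coord p).symm z)
  rw [hlin (coordFDeriv q u w) (1 * a), hlin (coordFDeriv q u w) (Complex.I * a),
    hlin (coordFDeriv q f w) (1 * a), hlin (coordFDeriv q f w) (Complex.I * a)]
  simp only [one_mul, Complex.mul_re, Complex.mul_im, Complex.I_re, Complex.I_im,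
    Complex.normSq_apply, Complex.real_smul]
  push_cast
  ring

theorem image_coordChange (p q : S) :
    (coord q ∘ (coord p).symm) '' ((coord p).target ∩ (coord p).symm ⁻¹' (coord q).source) =
      (coord q).target ∩ (coord q).symm ⁻¹' (coord p).source := by
  apply Subset.antisymm
  · rintro _ ⟨z, ⟨hz, hzq⟩, rfl⟩
    refine ⟨(coord q).map_source hzq, ?_⟩
    simp only [mem_preimage, Function.comp_apply]
    rw [(coord q).left_inv hzq]
    exact (coord p).map_target hz
  · rintro w ⟨hw, hwp⟩
    refine ⟨coord p ((coord q).symm w), ⟨(coord p).map_source hwp, ?_⟩, ?_⟩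
    · simp only [mem_preimage]
      rw [(coord p).left_inv hwp]
      exact (coord q).map_target hw
    · simp only [Function.comp_apply]
      rw [(coord p).left_inv hwp, (coord q).right_inv hw]

theorem injOn_coordChange (p q : S) :
    InjOn (coord q ∘ (coord p).symm) ((coord p).target ∩ (coord p).symm ⁻¹' (coord q).source) :=
  fun _ hz _ hw h => (coord p).symm.injOn hz.1 hw.1 ((coord q).injOn hz.2 hw.2 h)

/-- The integral of `v du ∧ df / f` over the intersection of two charts is the same in both. -/
theorem setIntegral_wedgeDlog_coordChange [IsManifold halfPlaneModel ω S]
    {u f v : S → ℂ} (hu : SmoothOnSurface u)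
    (hf : SmoothOnSurface f) (p q : S) :
    ∫ z in (coord p).target ∩ (coord p).symm ⁻¹' (coord q).source,
        inCoord p v z * wedgeDlog p u f z =
      ∫ z in (coord q).target ∩ (coord q).symm ⁻¹' (coord p).source,
        inCoord q v z * wedgeDlog q u f z := by
  rw [← image_coordChange p q, integral_image_eq_integral_abs_det_fderiv_smul volume
    (measurableSet_coord_preimage p (isOpen_coord_source q))
    (fun z hz => (hasFDerivWithinAt_coordChange hz.1 hz.2).mono
      (inter_subset_left.trans (coord_target_subset p))) (injOn_coordChange p q)]
  refine setIntegral_congr_fun (measurableSet_coord_preimage p (isOpen_coord_source q))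
    fun z hz => ?_
  simp only [det_toSpanSingleton_restrictScalars, Function.comp_apply,
    abs_of_nonneg (Complex.normSq_nonneg _), wedgeDlog_coordChange hu hf hz.1 hz.2, inCoord]
  rw [(coord q).left_inv hz.2, mul_smul_comm]

theorem continuousOn_wedgeDlog [IsManifold halfPlaneModel ω S]
    {u f : S → ℂ} (hu : SmoothOnSurface u) (hf : SmoothOnSurface f)
    (hf0 : ∀ x, f x ≠ 0) (p : S) : ContinuousOn (wedgeDlog p u f) (coord p).target := by
  intro z hz
  have hu1 := (hu.contDiffWithinAt_coordFDeriv hz).continuousWithinAt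
  have hf1 := (hf.contDiffWithinAt_coordFDeriv hz).continuousWithinAt
  have hf2 := (hf.contDiffWithinAt_inCoord hz).continuousWithinAt
  exact ((((hu1.clm_apply continuousWithinAt_const).mul
    (hf1.clm_apply continuousWithinAt_const)).sub ((hu1.clm_apply continuousWithinAt_const).mul
    (hf1.clm_apply continuousWithinAt_const))).div hf2 (hf0 _)).mono (coord_target_subset p)

theorem wedgeDlog_eq_zero {p : S} {u f : S → ℂ} {z : ℂ} (hz : z ∈ (coord p).target)
    (hu0 : (coord p).symm z ∉ tsupport u) : wedgeDlog p u f z = 0 := by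
  simp [wedgeDlog, coordFDeriv_eq_zero hz hu0]

/-- The sum over a finite partition of unity `u` of the integrals of `d(uᵢ) ∧ df / f` vanishes,
since `∑ d(uᵢ) = d(1) = 0`. -/
theorem sum_setIntegral_wedgeDlog [IsManifold halfPlaneModel ω S]
    [CompactSpace S] {ι : Type*} [Fintype ι] (p : ι → S)
    (u : ι → S → ℂ) {f : S → ℂ} (hu : ∀ i, SmoothOnSurface (u i)) (hf : SmoothOnSurface f)
    (hf0 : ∀ x, f x ≠ 0) (hup : ∀ i, tsupport (u i) ⊆ (coord (p i)).source)
    (hsum : ∀ x, ∑ i, u i x = 1) :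
    ∑ i, ∫ z in (coord (p i)).target, wedgeDlog (p i) (u i) f z = 0 := by
  have hcpt : ∀ i, IsCompact (tsupport (u i)) := fun i => (isClosed_tsupport _).isCompact
  have hcont : ∀ k i q, ContinuousOn (fun z => inCoord q (u k) z * wedgeDlog q (u i) f z)
      (coord q).target := fun k i q =>
    (((hu k).contDiffOn_inCoord q).continuousOn).mul (continuousOn_wedgeDlog (hu i) hf hf0 q)
  have hleft : ∀ i k, ∀ z ∈ (coord (p i)).target, (coord (p i)).symm z ∉ tsupport (u i) →
      inCoord (p i) (u k) z * wedgeDlog (p i) (u i) f z = 0 := fun i k z hz hzu => by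
    rw [wedgeDlog_eq_zero hz hzu, mul_zero]
  have hright : ∀ i k, ∀ z ∈ (coord (p k)).target, (coord (p k)).symm z ∉ tsupport (u k) →
      inCoord (p k) (u k) z * wedgeDlog (p k) (u i) f z = 0 := fun i k z hz hzu => by
    rw [inCoord, Function.comp_apply, image_eq_zero_of_notMem_tsupport hzu, zero_mul]
  -- both integrands are supported in the intersection of the two charts
  have hswap : ∀ i k,
      ∫ z in (coord (p i)).target, inCoord (p i) (u k) z * wedgeDlog (p i) (u i) f z =
        ∫ z in (coord (p k)).target, inCoord (p k) (u k) z * wedgeDlog (p k) (u i) f z := by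
    intro i k
    rw [setIntegral_eq_of_subset_of_forall_sdiff_eq_zero (measurableSet_coord_target (p i))
      (inter_subset_left (t := (coord (p i)).symm ⁻¹' (coord (p k)).source)) (fun z hz => ?_),
      setIntegral_wedgeDlog_coordChange (hu i) hf,
      setIntegral_eq_of_subset_of_forall_sdiff_eq_zero (measurableSet_coord_target (p k))
      (inter_subset_left (t := (coord (p k)).symm ⁻¹' (coord (p i)).source)) (fun z hz => ?_)]
    · rw [wedgeDlog_eq_zero hz.1 fun h => hz.2 ⟨hz.1, hup i h⟩, mul_zero]
    · rw [inCoord, Function.comp_apply,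
        image_eq_zero_of_notMem_tsupport fun h => hz.2 ⟨hz.1, hup k h⟩, zero_mul]
  calc ∑ i, ∫ z in (coord (p i)).target, wedgeDlog (p i) (u i) f z
      = ∑ i, ∑ k, ∫ z in (coord (p i)).target,
          inCoord (p i) (u k) z * wedgeDlog (p i) (u i) f z := by
        refine Finset.sum_congr rfl fun i _ => ?_
        rw [← integral_finsetSum _ fun k _ =>
          integrableOn_coord_target (hcpt i) (hup i) (hcont k i (p i)) (hleft i k)]
        refine integral_congr_ae (Filter.Eventually.of_forall fun z => ?_)
        simp only [← Finset.sum_mul, inCoord, Function.comp_apply, hsum, one_mul]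
    _ = ∑ k, ∑ i, ∫ z in (coord (p k)).target,
          inCoord (p k) (u k) z * wedgeDlog (p k) (u i) f z := by
        rw [Finset.sum_comm]
        exact Finset.sum_congr rfl fun k _ => Finset.sum_congr rfl fun i _ => hswap i k
    _ = 0 := by
        refine Finset.sum_eq_zero fun k _ => ?_
        rw [← integral_finsetSum _ fun i _ =>
          integrableOn_coord_target (hcpt k) (hup k) (hcont k i (p k)) (hright i k)]
        refine setIntegral_eq_zero_of_forall_eq_zero fun z hz => ?_
        have hd : ∑ i, coordFDeriv (p k) (u i) z = 0 := by
          have h1 := HasFDerivWithinAt.fun_sum fun i (_ : i ∈ Finset.univ) =>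
            (hu i).hasFDerivWithinAt_inCoord hz
          have h2 : (fun w => ∑ i, inCoord (p k) (u i) w) = fun _ => 1 := by
            funext w
            exact hsum _
          rw [h2] at h1
          exact (uniqueDiffOn_upperHalf z (coord_target_subset (p k) hz)).eq h1
            (hasFDerivWithinAt_const 1 z upperHalf)
        have hd' : ∀ v, ∑ i, coordFDeriv (p k) (u i) z v = 0 := fun v => by
          rw [← _root_.sum_apply, hd]
          rfl
        rw [← Finset.mul_sum]
        simp only [wedgeDlog, ← Finset.sum_div, Finset.sum_sub_distrib, ← Finset.sum_mul, hd']
        simp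

end Chart

/-! ### Continuous logarithms -/

theorem Complex.eq_of_exp_eq_one_on_Icc {h : ℝ → ℂ} {a b : ℝ} (hab : a ≤ b)
    (hc : ContinuousOn h (Icc a b)) (he : ∀ r ∈ Icc a b, Complex.exp (h r) = 1) : h b = h a := by
  have : PreconnectedSpace (Icc a b) := Subtype.preconnectedSpace isPreconnected_Icc
  exact Complex.isCoveringMap_exp.const_of_comp (g := (Icc a b).domRestrict h) hc.domRestrict
    (fun x y => Subtype.ext ((he x x.2).trans (he y y.2).symm))
    ⟨b, right_mem_Icc.2 hab⟩ ⟨a, left_mem_Icc.2 hab⟩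

/-- The integral of the logarithmic derivative of `F` is the increment of any continuous
logarithm of `F` along a monotone reparametrization `X`. -/
theorem setIntegral_logDeriv_eq_sub {O : Set ℝ} (hO : IsOpen O) {F F' : ℝ → ℂ}
    (hF : ∀ x ∈ O, HasDerivAt F (F' x) x) (hF' : ContinuousOn F' O) (h0 : ∀ x ∈ O, F x ≠ 0)
    {X : ℝ → ℝ} {s s' : ℝ} (hs : s ≤ s') (hX : ContinuousOn X (Icc s s'))
    (hXm : MonotoneOn X (Icc s s')) (hXO : Icc (X s) (X s') ⊆ O) {l : ℝ → ℂ}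
    (hl : ContinuousOn l (Icc s s')) (he : ∀ r ∈ Icc s s', Complex.exp (l r) = F (X r)) :
    ∫ x in Icc (X s) (X s'), F' x / F x = l s' - l s := by
  have hss := left_mem_Icc.2 hs
  have hss' := right_mem_Icc.2 hs
  have hle : X s ≤ X s' := hXm hss hss' hs
  have hFc : ContinuousOn F O := fun x hx => (hF x hx).continuousAt.continuousWithinAt
  have hq : ContinuousOn (fun x => F' x / F x) O := hF'.div hFc h0
  set m : ℝ → ℂ := fun y => ∫ x in (X s)..y, F' x / F x
  have hm : ∀ y ∈ Icc (X s) (X s'), HasDerivAt m (F' y / F y) y := fun y hy => by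
    have hyO := hXO hy
    refine intervalIntegral.integral_hasDerivAt_right ?_
      (hq.stronglyMeasurableAtFilter hO y hyO) (hq.continuousAt (hO.mem_nhds hyO))
    refine (hq.mono ?_).intervalIntegrable
    rw [uIcc_of_le hy.1]
    exact (Icc_subset_Icc_right hy.2).trans hXO
  have hmexp : ∀ y ∈ Icc (X s) (X s'), F y * Complex.exp (-m y) = F (X s) := fun y hy => by
    have hd : ∀ y ∈ Icc (X s) (X s'), HasDerivAt (fun y => F y * Complex.exp (-m y)) 0 y :=
      fun y hy => by
        have h := (hF y (hXO hy)).mul (hm y hy).neg.cexp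
        convert! h using 1
        have := h0 y (hXO hy)
        field_simp
        ring
    have h := constant_of_has_deriv_right_zero
      (fun y hy => (hd y hy).continuousAt.continuousWithinAt)
      (fun y hy => (hd y (Ico_subset_Icc_self hy)).hasDerivWithinAt) y hy
    simpa [m] using h
  have hmaps : MapsTo X (Icc s s') (Icc (X s) (X s')) := fun r hr =>
    ⟨hXm hss hr hr.1, hXm hr hss' hr.2⟩
  have hmc : ContinuousOn (fun r => l r - l s - m (X r)) (Icc s s') :=
    (hl.sub continuousOn_const).sub
      (ContinuousOn.comp (fun y hy => (hm y hy).continuousAt.continuousWithinAt) hX hmaps)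
  have h1 := Complex.eq_of_exp_eq_one_on_Icc hs hmc fun r hr => by
    have h2 := hmexp _ (hmaps hr)
    rw [sub_right_comm, sub_eq_add_neg, sub_eq_add_neg, Complex.exp_add, Complex.exp_add, he r hr,
      h2, ← he s hss, ← Complex.exp_add]
    simp
  have h3 : m (X s') = l s' - l s := by
    have h4 : m (X s) = 0 := by simp [m]
    simp only [h4, sub_self] at h1
    exact (sub_eq_zero.1 h1).symm
  rw [← h3, integral_Icc_eq_integral_Ioc, ← intervalIntegral.integral_of_le hle]

/-! ### Integration over the boundary in a chart -/

section Chart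

variable {S : Type*} [TopologicalSpace S] [ChartedSpace ClosedHalfPlane S]

/-- The set of real parameters, in the chart at `p`, of the points of `A`. -/
def realParams (p : S) (A : Set S) : Set ℝ :=
  {x | (x : ℂ) ∈ (coord p).target ∧ (coord p).symm x ∈ A}

theorem isOpen_realParams (p : S) {U : Set S} (hU : IsOpen U) : IsOpen (realParams p U) := by
  refine isOpen_iff_mem_nhds.2 fun x hx => ?_
  have h := coord_symm_preimage_mem_nhdsWithin hx.1 hU hx.2
  have h2 : Filter.Tendsto (fun x : ℝ => (x : ℂ)) (𝓝 x) (𝓝[upperHalf] x) :=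
    tendsto_nhdsWithin_iff.2 ⟨Complex.continuous_ofReal.continuousAt,
      Filter.Eventually.of_forall ofReal_mem_upperHalf⟩
  exact h2 h

theorem realParams_inter (p : S) (A B : Set S) :
    realParams p (A ∩ B) = realParams p A ∩ realParams p B := by
  ext x
  simp only [realParams, mem_ofPred_eq, mem_inter_iff]
  tauto

theorem realParams_mono (p : S) {A B : Set S} (h : A ⊆ B) : realParams p A ⊆ realParams p B :=
  fun _ hx => ⟨hx.1, h hx.2⟩

theorem measurableSet_realParams (p : S) {A : Set S} (hA : IsClosed A) :
    MeasurableSet (realParams p A) := by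
  have h : realParams p A = realParams p univ \ realParams p Aᶜ := by
    ext x
    simp only [realParams, mem_ofPred_eq, mem_sdiff, mem_univ, mem_compl_iff]
    tauto
  rw [h]
  exact MeasurableSet.diff (isOpen_realParams p isOpen_univ).measurableSet
    (isOpen_realParams p hA.isOpen_compl).measurableSet

theorem finite_realParams (p : S) {A : Set S} (hA : A.Finite) : (realParams p A).Finite := by
  refine Set.Finite.of_finite_image (f := fun x : ℝ => (coord p).symm x)
    (hA.subset (by rintro _ ⟨x, hx, rfl⟩; exact hx.2)) fun x hx y hy h => ?_
  exact Complex.ofReal_injective ((coord p).symm.injOn hx.1 hy.1 h)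

theorem integrableOn_smulDlog [IsManifold halfPlaneModel ω S] {p : S} {u f : S → ℂ}
    (hu : SmoothOnSurface u) (hf : SmoothOnSurface f) (hf0 : ∀ x, f x ≠ 0)
    (huc : IsCompact (tsupport u)) (hup : tsupport u ⊆ (coord p).source) :
    IntegrableOn (fun x : ℝ => smulDlog p u f 1 x) (realParams p univ) := by
  have hKc := huc.image_of_continuousOn
    ((continuousOn_extChartAt (I := halfPlaneModel) p).mono hup)
  have hK : IsCompact ((fun x : ℝ => (x : ℂ)) ⁻¹' (coord p '' tsupport u)) :=
    Complex.isometry_ofReal.isClosedEmbedding.isCompact_preimage hKc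
  have hsub : coord p '' tsupport u ⊆ (coord p).target := by
    rintro _ ⟨x, hx, rfl⟩
    exact (coord p).map_source (hup hx)
  have hc : ContinuousOn (smulDlog p u f 1) (coord p).target := fun z hz =>
    (contDiffWithinAt_smulDlog hu hf hf0 p 1 hz).continuousWithinAt.mono (coord_target_subset p)
  refine (((hc.comp Complex.continuous_ofReal.continuousOn fun x hx =>
    hsub hx)).integrableOn_compact hK).of_forall_sdiff_eq_zero
    (isOpen_realParams p isOpen_univ).measurableSet fun x hx => ?_
  have hxu : (coord p).symm x ∉ tsupport u := fun h =>
    hx.2 ⟨_, h, (coord p).right_inv hx.1.1⟩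
  have h0 : inCoord p u x = 0 := image_eq_zero_of_notMem_tsupport (f := u) hxu
  change inCoord p u x * coordFDeriv p f x 1 / inCoord p f x = 0
  rw [h0, zero_mul, zero_div]

/-- A change of coordinates between charts in the half plane preserves the boundary and its
orientation: at a boundary point its derivative is a nonnegative real number. -/
theorem coordDeriv_boundary [IsManifold halfPlaneModel ω S] {p q : S} {x : ℝ}
    (hx : x ∈ realParams p (coord q).source) :
    (coordDeriv p q x).im = 0 ∧ 0 ≤ (coordDeriv p q x).re ∧
      HasDerivAt (fun y : ℝ => (coord q ((coord p).symm y)).re) (coordDeriv p q x).re x := by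
  have hd := hasDerivWithinAt_coordChange hx.1 hx.2
  have hO := (isOpen_realParams p (isOpen_coord_source q)).mem_nhds hx
  have h1 : HasDerivAt (fun y : ℝ => coord q ((coord p).symm y)) (coordDeriv p q x) x := by
    have h := HasDerivWithinAt.scomp_of_eq (t' := upperHalf) (s := univ) x hd
      (Complex.ofRealCLM.hasDerivAt (x := x)).hasDerivWithinAt
      (fun y _ => ofReal_mem_upperHalf y) rfl
    simpa [Function.comp_def] using h.hasDerivAt
  have hre := Complex.reCLM.hasFDerivAt.comp_hasDerivAt x h1
  have him := Complex.imCLM.hasFDerivAt.comp_hasDerivAt x h1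
  have himz : (fun y : ℝ => (coord q ((coord p).symm y)).im) =ᶠ[𝓝 x] fun _ => 0 := by
    filter_upwards [hO] with y hy
    rw [← mem_surfaceBoundary_iff_coord_im hy.2, mem_surfaceBoundary_iff_im hy.1]
    exact Complex.ofReal_im y
  refine ⟨?_, ?_, hre⟩
  · exact (him.congr_of_eventuallyEq himz.symm).unique (hasDerivAt_const x (0 : ℝ))
  · -- the imaginary part grows along the inner normal `i`
    have hg : HasDerivWithinAt (fun t : ℝ => (x : ℂ) + t * Complex.I) Complex.I (Ici 0) 0 := by
      have h := ((Complex.ofRealCLM.hasDerivAt (x := (0 : ℝ))).mul_const Complex.I).const_add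
        (x : ℂ)
      simpa using h.hasDerivWithinAt
    have h2 := HasDerivWithinAt.scomp_of_eq (t' := upperHalf) (0 : ℝ) hd hg (fun t ht => by
      simpa [upperHalf] using ht) (by simp)
    have h3 : HasDerivWithinAt (fun t : ℝ => (coord q ((coord p).symm (x + t * Complex.I))).im)
        (coordDeriv p q x).re (Ici 0) 0 := by
      have h := Complex.imCLM.hasFDerivAt.comp_hasDerivWithinAt (0 : ℝ) h2
      have h4 : (Complex.imCLM (Complex.I • coordDeriv p q x)) = (coordDeriv p q x).re := by
        simp
      rwa [h4] at h
    rw [hasDerivWithinAt_iff_tendsto_slope, Ici_sdiff_left] at h3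
    refine ge_of_tendsto h3 ?_
    have hnear : ∀ᶠ t : ℝ in 𝓝[>] 0, (x + t * Complex.I : ℂ) ∈
        (coord p).target ∩ (coord p).symm ⁻¹' (coord q).source := by
      have ht : Filter.Tendsto (fun t : ℝ => (x + t * Complex.I : ℂ)) (𝓝[>] 0)
          (𝓝[upperHalf] x) := by
        refine tendsto_nhdsWithin_iff.2 ⟨?_, ?_⟩
        · have hc : Continuous fun t : ℝ => (x + t * Complex.I : ℂ) := by fun_prop
          simpa using (hc.tendsto 0).mono_left nhdsWithin_le_nhds
        · filter_upwards [self_mem_nhdsWithin] with t ht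
          simpa [upperHalf] using ht.le
      exact ht (coord_symm_preimage_mem_nhdsWithin hx.1 (isOpen_coord_source q) hx.2)
    filter_upwards [hnear, self_mem_nhdsWithin] with t ht htpos
    have h0 : (coord q ((coord p).symm x)).im = 0 := himz.self_of_nhds
    have h1 : 0 ≤ (coord q ((coord p).symm (x + t * Complex.I))).im :=
      coord_target_subset q ((coord q).map_source ht.2)
    have htpos : (0 : ℝ) < t := htpos
    rw [slope_def_field]
    simp only [Complex.ofReal_zero, zero_mul, add_zero, h0, sub_zero]
    positivity

end Chart

/-! ### The boundary integral of `df / f` -/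

section Chart

variable {S : Type*} [TopologicalSpace S] [ChartedSpace ClosedHalfPlane S]

/-- The integral of `u df / f` over a part `A` of the boundary does not depend on the chart. -/
theorem setIntegral_smulDlog_coordChange [IsManifold halfPlaneModel ω S] {u f : S → ℂ}
    (hf : SmoothOnSurface f) (p q : S) {A : Set S} (hA : MeasurableSet (realParams p A))
    (hAp : A ⊆ (coord p).source) (hAq : A ⊆ (coord q).source) :
    ∫ x in realParams q A, smulDlog q u f 1 x = ∫ x in realParams p A, smulDlog p u f 1 x := by
  have hsub : realParams p A ⊆ realParams p (coord q).source := realParams_mono p hAq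
  have hreal : ∀ p q : S, ∀ x ∈ realParams p (coord q).source,
      (((coord q ((coord p).symm x)).re : ℝ) : ℂ) = coord q ((coord p).symm x) :=
    fun p q x hx => by
      have h1 : (coord q ((coord p).symm x)).im = 0 := by
        rw [← mem_surfaceBoundary_iff_coord_im hx.2, mem_surfaceBoundary_iff_im hx.1]
        exact Complex.ofReal_im x
      exact Complex.ext (by simp) (by simp [h1])
  have himg : (fun x : ℝ => (coord q ((coord p).symm x)).re) '' realParams p A =
      realParams q A := by
    apply Subset.antisymm
    · rintro _ ⟨x, hx, rfl⟩
      simp only [realParams, mem_ofPred_eq]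
      rw [hreal p q x (hsub hx), (coord q).left_inv (hAq hx.2)]
      exact ⟨(coord q).map_source (hAq hx.2), hx.2⟩
    · intro y hy
      have hy' := hreal q p y (realParams_mono q hAp hy)
      refine ⟨(coord p ((coord q).symm y)).re, ?_, ?_⟩
      · simp only [realParams, mem_ofPred_eq]
        rw [hy', (coord p).left_inv (hAp hy.2)]
        exact ⟨(coord p).map_source (hAp hy.2), hy.2⟩
      · simp only
        rw [hy', (coord p).left_inv (hAp hy.2), (coord q).right_inv hy.1, Complex.ofReal_re]
  have hinj : InjOn (fun x : ℝ => (coord q ((coord p).symm x)).re) (realParams p A) := by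
    intro x hx y hy h
    have h' : coord q ((coord p).symm x) = coord q ((coord p).symm y) := by
      rw [← hreal p q x (hsub hx), ← hreal p q y (hsub hy)]
      exact congrArg _ h
    exact Complex.ofReal_injective (injOn_coordChange p q ⟨hx.1, hAq hx.2⟩ ⟨hy.1, hAq hy.2⟩ h')
  rw [← himg, integral_image_eq_integral_abs_deriv_smul hA
    (fun x hx => (coordDeriv_boundary (hsub hx)).2.2.hasDerivWithinAt) hinj]
  refine setIntegral_congr_fun hA fun x hx => ?_
  obtain ⟨h1, h2, -⟩ := coordDeriv_boundary (hsub hx)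
  have ha : (1 : ℂ) * coordDeriv p q x = (coordDeriv p q x).re • (1 : ℂ) := by
    apply Complex.ext <;> simp [h1]
  simp only [abs_of_nonneg h2, hreal p q x (hsub hx), smulDlog,
    hf.coordFDeriv_apply hx.1 (hAq hx.2), ha, map_smul, inCoord, Function.comp_apply]
  rw [(coord q).left_inv (hAq hx.2)]
  simp only [Complex.real_smul]
  ring

variable {ι : Type*} [Fintype ι]

/-- The integral of `∑ᵢ uᵢ df / f` over the part `A` of the boundary, where the `i`-th term is
computed in the chart at `p i`.  Only the boundary points of `A` matter. -/
def boundaryIntegral (p : ι → S) (u : ι → S → ℂ) (f : S → ℂ) (A : Set S) : ℂ :=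
  ∑ i, ∫ x in realParams (p i) A, smulDlog (p i) (u i) f 1 x

variable {p : ι → S} {u : ι → S → ℂ} {f : S → ℂ}

theorem integrableOn_smulDlog_realParams {ι : Type*} {p : ι → S} {u : ι → S → ℂ}
    [IsManifold halfPlaneModel ω S] [CompactSpace S] (hu : ∀ i, SmoothOnSurface (u i))
    (hf : SmoothOnSurface f) (hf0 : ∀ x, f x ≠ 0)
    (hup : ∀ i, tsupport (u i) ⊆ (coord (p i)).source) (i : ι) (A : Set S) :
    IntegrableOn (fun x : ℝ => smulDlog (p i) (u i) f 1 x) (realParams (p i) A) :=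
  (integrableOn_smulDlog (hu i) hf hf0 (isClosed_tsupport _).isCompact (hup i)).mono_set
    (realParams_mono _ (subset_univ A))

/-- The boundary integral is additive; overlaps in finitely many points are negligible. -/
theorem boundaryIntegral_union [IsManifold halfPlaneModel ω S] [CompactSpace S]
    (hu : ∀ i, SmoothOnSurface (u i)) (hf : SmoothOnSurface f)
    (hf0 : ∀ x, f x ≠ 0) (hup : ∀ i, tsupport (u i) ⊆ (coord (p i)).source) {A B : Set S}
    (hB : IsClosed B) (hAB : (A ∩ B).Finite) :
    boundaryIntegral p u f (A ∪ B) = boundaryIntegral p u f A + boundaryIntegral p u f B := by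
  simp only [boundaryIntegral]
  rw [← Finset.sum_add_distrib]
  refine Finset.sum_congr rfl fun i _ => ?_
  have hun : realParams (p i) (A ∪ B) = realParams (p i) A ∪ realParams (p i) B := by
    ext x
    simp only [realParams, mem_ofPred_eq, mem_union]
    tauto
  rw [hun, setIntegral_union₀ ?_ (measurableSet_realParams _ hB).nullMeasurableSet
    (integrableOn_smulDlog_realParams hu hf hf0 hup i A)
    (integrableOn_smulDlog_realParams hu hf hf0 hup i B)]
  rw [AEDisjoint, ← realParams_inter]
  exact (finite_realParams _ hAB).measure_zero _

theorem boundaryIntegral_finite {A : Set S} (hA : A.Finite) : boundaryIntegral p u f A = 0 := by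
  refine Finset.sum_eq_zero fun i _ => ?_
  rw [Measure.restrict_eq_zero.2 ((finite_realParams (p i) hA).measure_zero _),
    integral_zero_measure]

theorem boundaryIntegral_iUnion [IsManifold halfPlaneModel ω S] [CompactSpace S]
    (hu : ∀ i, SmoothOnSurface (u i)) (hf : SmoothOnSurface f)
    (hf0 : ∀ x, f x ≠ 0) (hup : ∀ i, tsupport (u i) ⊆ (coord (p i)).source) {κ : Type*} [Fintype κ]
    {A : κ → Set S} (hA : ∀ k, IsClosed (A k)) (hd : Pairwise (Function.onFun Disjoint A)) :
    boundaryIntegral p u f (⋃ k, A k) = ∑ k, boundaryIntegral p u f (A k) := by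
  simp only [boundaryIntegral]
  rw [Finset.sum_comm]
  refine Finset.sum_congr rfl fun i _ => ?_
  have hun : realParams (p i) (⋃ k, A k) = ⋃ k, realParams (p i) (A k) := by
    ext x
    simp [realParams]
  rw [hun, integral_iUnion_fintype (fun k => measurableSet_realParams _ (hA k)) ?_
    fun k => integrableOn_smulDlog_realParams hu hf hf0 hup i (A k)]
  exact fun k l hkl => disjoint_left.2 fun x hx hy => disjoint_left.1 (hd hkl) hx.2 hy.2

/-- Stokes' theorem on the surface: the form `df / f` is closed, so that its integral over the
whole boundary vanishes. -/
theorem boundaryIntegral_surfaceBoundary [IsManifold halfPlaneModel ω S] [CompactSpace S]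
    (hu : ∀ i, SmoothOnSurface (u i))
    (hf : SmoothOnSurface f) (hf0 : ∀ x, f x ≠ 0)
    (hup : ∀ i, tsupport (u i) ⊆ (coord (p i)).source) (hsum : ∀ x, ∑ i, u i x = 1) :
    boundaryIntegral p u f (surfaceBoundary S) = 0 := by
  rw [← sum_setIntegral_wedgeDlog p u hu hf hf0 hup hsum]
  refine Finset.sum_congr rfl fun i _ => ?_
  rw [setIntegral_wedgeDlog (hu i) hf hf0 (isClosed_tsupport _).isCompact (hup i)]
  have hb : realParams (p i) (surfaceBoundary S) = realParams (p i) univ := by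
    ext x
    refine ⟨fun h => ⟨h.1, mem_univ _⟩, fun h => ⟨h.1, ?_⟩⟩
    rw [mem_surfaceBoundary_iff_im h.1]
    exact Complex.ofReal_im x
  rw [hb, ← integral_indicator (isOpen_realParams _ isOpen_univ).measurableSet]
  refine integral_congr_ae (Filter.Eventually.of_forall fun x => ?_)
  by_cases hx : (x : ℂ) ∈ (coord (p i)).target
  · simp only
    rw [indicator_of_mem hx, indicator_of_mem (show x ∈ realParams (p i) univ from ⟨hx, trivial⟩)]
  · simp only
    rw [indicator_of_notMem hx, indicator_of_notMem fun h => hx h.1]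

/-- The boundary integral over a set contained in one chart can be computed in that chart, where
the functions of the partition of unity add up to `1`. -/
theorem boundaryIntegral_eq_of_subset_source [IsManifold halfPlaneModel ω S]
    (hu : ∀ i, SmoothOnSurface (u i)) (hf : SmoothOnSurface f) (hf0 : ∀ x, f x ≠ 0)
    (hup : ∀ i, tsupport (u i) ⊆ (coord (p i)).source) (hsum : ∀ x, ∑ i, u i x = 1)
    {A : Set S} {q : S} (hA : IsCompact (realParams q A)) (hAq : A ⊆ (coord q).source) :
    boundaryIntegral p u f A =
      ∫ x in realParams q A, coordFDeriv q f x 1 / inCoord q f x := by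
  have hterm : ∀ i, ∫ x in realParams (p i) A, smulDlog (p i) (u i) f 1 x =
      ∫ x in realParams q A, smulDlog q (u i) f 1 x := fun i => by
    have h1 : realParams (p i) A = realParams (p i) (A ∩ (coord (p i)).source) := by
      ext x
      exact ⟨fun h => ⟨h.1, h.2, (coord (p i)).map_target h.1⟩, fun h => ⟨h.1, h.2.1⟩⟩
    have hmeas : MeasurableSet (realParams q (A ∩ (coord (p i)).source)) := by
      rw [realParams_inter]
      exact hA.measurableSet.inter
        (isOpen_realParams q (isOpen_coord_source (p i))).measurableSet
    rw [h1, setIntegral_smulDlog_coordChange hf q (p i) hmeas (inter_subset_left.trans hAq)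
      inter_subset_right]
    refine (setIntegral_eq_of_subset_of_forall_sdiff_eq_zero hA.measurableSet
      (realParams_mono q inter_subset_left) fun x hx => ?_).symm
    have h0 : inCoord q (u i) x = 0 := image_eq_zero_of_notMem_tsupport (f := u i) fun h =>
      hx.2 ⟨hx.1.1, hx.1.2, hup i h⟩
    rw [smulDlog, h0, zero_mul, zero_div]
  have hint : ∀ i, IntegrableOn (fun x : ℝ => smulDlog q (u i) f 1 x) (realParams q A) :=
    fun i => by
      refine ContinuousOn.integrableOn_compact hA ?_
      have hc : ContinuousOn (smulDlog q (u i) f 1) (coord q).target := fun z hz =>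
        (contDiffWithinAt_smulDlog (hu i) hf hf0 q 1 hz).continuousWithinAt.mono
          (coord_target_subset q)
      exact hc.comp Complex.continuous_ofReal.continuousOn fun x hx => hx.1
  rw [boundaryIntegral, Finset.sum_congr rfl fun i _ => hterm i,
    ← integral_finsetSum _ fun i _ => hint i]
  refine setIntegral_congr_fun hA.measurableSet fun x hx => ?_
  have h1 : ∑ i, inCoord q (u i) x = 1 := hsum _
  simp only [smulDlog, ← Finset.sum_div, ← Finset.sum_mul, h1, one_mul]

end Chart

theorem hasDerivAt_inCoord_ofReal {S : Type*} [TopologicalSpace S]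
    [ChartedSpace ClosedHalfPlane S] [IsManifold halfPlaneModel ω S] {f : S → ℂ}
    (hf : SmoothOnSurface f) {q : S} {x : ℝ} (hx : x ∈ realParams q univ) :
    HasDerivAt (fun y : ℝ => inCoord q f y) (coordFDeriv q f x 1) x := by
  have h := HasFDerivWithinAt.comp_hasDerivWithinAt_of_eq (t := upperHalf) (s := univ) x
    (hf.hasFDerivWithinAt_inCoord hx.1) (Complex.ofRealCLM.hasDerivAt (x := x)).hasDerivWithinAt
    (fun y _ => ofReal_mem_upperHalf y) rfl
  simpa [Function.comp_def] using h.hasDerivAt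

theorem Circle.exists_exp_eq (x : Circle) : ∃ r ∈ Icc 0 (2 * Real.pi), Circle.exp r = x := by
  have h1 := Complex.neg_pi_lt_arg (x : ℂ)
  have h2 := Complex.arg_le_pi (x : ℂ)
  rcases le_total 0 (Complex.arg x) with h | h
  · exact ⟨Complex.arg x, ⟨h, by linarith [Real.pi_pos]⟩, Circle.exp_arg x⟩
  · exact ⟨Complex.arg x + 2 * Real.pi, ⟨by linarith, by linarith⟩, by
      rw [Circle.exp_add_two_pi, Circle.exp_arg]⟩

/-! ### The integral over a boundary circle -/

section Circle

variable {S : Type*} [TopologicalSpace S] [ChartedSpace ClosedHalfPlane S]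

/-- The part of a boundary circle `c` traversed between the times `s` and `t`. -/
def circleArc (c : C(Circle, surfaceBoundary S)) (s t : ℝ) : Set S :=
  (fun r => (c (Circle.exp r) : S)) '' Icc s t

theorem continuous_circle_param (c : C(Circle, surfaceBoundary S)) :
    Continuous fun r => (c (Circle.exp r) : S) :=
  continuous_subtype_val.comp (c.continuous.comp Circle.exp.continuous)

variable {ι : Type*} [Fintype ι] {p : ι → S} {u : ι → S → ℂ} {f : S → ℂ}

/-- Along a short arc of an oriented boundary circle the boundary integral of `df / f` is the
increment of a continuous logarithm of `f`. -/
theorem eventually_boundaryIntegral_circleArc [IsManifold halfPlaneModel ω S]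
    (hu : ∀ i, SmoothOnSurface (u i)) (hf : SmoothOnSurface f) (hf0 : ∀ x, f x ≠ 0)
    (hup : ∀ i, tsupport (u i) ⊆ (coord (p i)).source) (hsum : ∀ x, ∑ i, u i x = 1)
    {R : ConnectedComponents (surfaceBoundary S)} {c : C(Circle, surfaceBoundary S)}
    (hc : IsOrientedBoundaryCircle R c) {l : ℝ → ℂ} (hl : Continuous l)
    (hle : ∀ t, Complex.exp (l t) = f (c (Circle.exp t))) (t : ℝ) :
    ∃ δ > 0, ∀ s s', t - δ < s → s ≤ s' → s' < t + δ →
      boundaryIntegral p u f (circleArc c s s') = l s' - l s := by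
  set q : S := (c (Circle.exp t) : S)
  set γ : ℝ → S := fun r => (c (Circle.exp r) : S)
  have hγ : Continuous γ := continuous_circle_param c
  have hqs : ∀ x, x ∈ (chartAt ClosedHalfPlane q).source ↔ x ∈ (coord q).source := fun x => by
    rw [coord_source]
  have hqmem : γ t ∈ (coord q).source := (hqs _).1 (mem_chart_source _ q)
  obtain ⟨N, hN, hmono⟩ := hc.positive _ (chart_mem_atlas ClosedHalfPlane q) t ((hqs _).2 hqmem)
  have hsrc : γ ⁻¹' (coord q).source ∈ 𝓝 t :=
    hγ.continuousAt.preimage_mem_nhds ((isOpen_coord_source q).mem_nhds hqmem)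
  obtain ⟨δ, hδ, hball⟩ := Metric.mem_nhds_iff.1 (Filter.inter_mem hN hsrc)
  rw [Real.ball_eq_Ioo] at hball
  refine ⟨δ, hδ, fun s s' hs hss' hs' => ?_⟩
  set X : ℝ → ℝ := fun r => (coord q (γ r)).re
  have hIcc : Icc s s' ⊆ N ∩ γ ⁻¹' (coord q).source := fun r hr =>
    hball ⟨hs.trans_le hr.1, hr.2.trans_lt hs'⟩
  have hXmono : StrictMonoOn X (Icc s s') := hmono.mono fun r hr => (hIcc hr).1
  have hXcont : ContinuousOn X (Icc s s') :=
    Complex.continuous_re.comp_continuousOn ((continuousOn_extChartAt q).comp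
      hγ.continuousOn fun r hr => (hIcc hr).2)
  have hXγ : ∀ r ∈ Icc s s', ((X r : ℝ) : ℂ) = coord q (γ r) := fun r hr => by
    have h := (mem_surfaceBoundary_iff_coord_im (hIcc hr).2).1 (c (Circle.exp r)).2
    exact Complex.ext (by simp [X]) (by simpa using h.symm)
  have hXimage : X '' Icc s s' = Icc (X s) (X s') := by
    apply Subset.antisymm
    · rintro _ ⟨r, hr, rfl⟩
      exact ⟨hXmono.monotoneOn (left_mem_Icc.2 hss') hr hr.1,
        hXmono.monotoneOn hr (right_mem_Icc.2 hss') hr.2⟩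
    · exact intermediate_value_Icc hss' hXcont
  have hparams : realParams q (circleArc c s s') = Icc (X s) (X s') := by
    rw [← hXimage]
    apply Subset.antisymm
    · rintro x ⟨hx, r, hr, hrx⟩
      refine ⟨r, hr, ?_⟩
      have h : coord q (γ r) = x := by
        change γ r = _ at hrx
        rw [hrx, (coord q).right_inv hx]
      simp [X, h]
    · rintro _ ⟨r, hr, rfl⟩
      simp only [realParams, mem_ofPred_eq]
      rw [hXγ r hr, (coord q).left_inv (hIcc hr).2]
      exact ⟨(coord q).map_source (hIcc hr).2, r, hr, rfl⟩
  have harc : circleArc c s s' ⊆ (coord q).source := by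
    rintro _ ⟨r, hr, rfl⟩
    exact (hIcc hr).2
  rw [boundaryIntegral_eq_of_subset_source hu hf hf0 hup hsum (by rw [hparams]; exact isCompact_Icc)
    harc, hparams]
  refine setIntegral_logDeriv_eq_sub (F := fun x => inCoord q f x)
    (F' := fun x => coordFDeriv q f x 1) (isOpen_realParams q isOpen_univ)
    (fun x hx => hasDerivAt_inCoord_ofReal hf hx) ?_ (fun x _ => hf0 _) hss' hXcont
    hXmono.monotoneOn ?_ hl.continuousOn fun r hr => ?_
  · have h : ContinuousOn (fun z => coordFDeriv q f z 1) (coord q).target := fun z hz =>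
      (((hf.contDiffWithinAt_coordFDeriv hz).continuousWithinAt.clm_apply
        continuousWithinAt_const)).mono (coord_target_subset q)
    exact h.comp Complex.continuous_ofReal.continuousOn fun x hx => hx.1
  · rw [← hparams]
    exact realParams_mono q (subset_univ _)
  · rw [hle, hXγ r hr, inCoord, Function.comp_apply, (coord q).left_inv (hIcc hr).2]

/-- The integral of `df / f` over an oriented boundary circle is the total increment of a continuous
logarithm of `f`. -/
theorem boundaryIntegral_range_circle [IsManifold halfPlaneModel ω S] [CompactSpace S] [T2Space S]
    (hu : ∀ i, SmoothOnSurface (u i)) (hf : SmoothOnSurface f) (hf0 : ∀ x, f x ≠ 0)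
    (hup : ∀ i, tsupport (u i) ⊆ (coord (p i)).source) (hsum : ∀ x, ∑ i, u i x = 1)
    {R : ConnectedComponents (surfaceBoundary S)} {c : C(Circle, surfaceBoundary S)}
    (hc : IsOrientedBoundaryCircle R c) {l : ℝ → ℂ} (hl : Continuous l)
    (hle : ∀ t, Complex.exp (l t) = f (c (Circle.exp t))) :
    boundaryIntegral p u f (range fun x => (c x : S)) = l (2 * Real.pi) - l 0 := by
  have hpi := Real.two_pi_pos
  have hadd : ∀ s s', 0 ≤ s → s ≤ s' → s' ≤ 2 * Real.pi →
      boundaryIntegral p u f (circleArc c 0 s') =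
        boundaryIntegral p u f (circleArc c 0 s) + boundaryIntegral p u f (circleArc c s s') := by
    intro s s' hs hss' hs'
    have hun : circleArc c 0 s' = circleArc c 0 s ∪ circleArc c s s' := by
      rw [circleArc, circleArc, circleArc, ← image_union, Icc_union_Icc_eq_Icc hs hss']
    have hclosed : IsClosed (circleArc c s s') :=
      (isCompact_Icc.image (continuous_circle_param c)).isClosed
    rw [hun, boundaryIntegral_union hu hf hf0 hup hclosed]
    refine ((finite_singleton (c (Circle.exp s) : S)).insert (c (Circle.exp 0) : S)).subset ?_
    rintro _ ⟨⟨a, ha, rfl⟩, b, hb, hab⟩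
    -- consecutive arcs meet where they join, and at the base point after a full turn
    obtain ⟨m, hm⟩ := Circle.exp_eq_exp.1 (hc.injective (Subtype.ext hab))
    have hm0 : 0 ≤ m := by
      by_contra! hneg
      have : (m : ℝ) ≤ -1 := by exact_mod_cast Int.le_sub_one_of_lt hneg
      nlinarith [ha.2, hb.1]
    obtain rfl | hm1 := hm0.eq_or_lt
    · have : a = s := by
        have h0 := ha.2
        have h1 := hb.1
        simp only [Int.cast_zero, zero_mul, add_zero] at hm
        linarith
      rw [this]
      exact Or.inr rfl
    · have : a = 0 := by
        have : (1 : ℝ) ≤ m := by exact_mod_cast hm1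
        nlinarith [ha.1, hb.2]
      rw [this]
      exact Or.inl rfl
  set d : Icc 0 (2 * Real.pi) → ℂ := fun t =>
    boundaryIntegral p u f (circleArc c 0 t) - (l t - l 0)
  have hd : IsLocallyConstant d := by
    rw [IsLocallyConstant.iff_eventually_eq]
    intro t
    obtain ⟨δ, hδ, h⟩ := eventually_boundaryIntegral_circleArc hu hf hf0 hup hsum hc hl hle t
    have hnear : ∀ᶠ r : Icc 0 (2 * Real.pi) in 𝓝 t, (r : ℝ) ∈ Ioo (t - δ : ℝ) (t + δ) :=
      continuous_subtype_val.continuousAt.preimage_mem_nhds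
        (Ioo_mem_nhds (by linarith) (by linarith))
    filter_upwards [hnear] with r hr
    rcases le_total (r : ℝ) t with hrt | hrt
    · have h1 := hadd r t r.2.1 hrt t.2.2
      rw [h r t hr.1 hrt (by linarith)] at h1
      simp only [d, h1]
      ring
    · have h1 := hadd t r t.2.1 hrt r.2.2
      rw [h t r (by linarith) hrt hr.2] at h1
      simp only [d, h1]
      ring
  have : PreconnectedSpace (Icc 0 (2 * Real.pi)) := Subtype.preconnectedSpace isPreconnected_Icc
  have h := hd.apply_eq_of_preconnectedSpace ⟨2 * Real.pi, right_mem_Icc.2 hpi.le⟩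
    ⟨0, left_mem_Icc.2 hpi.le⟩
  have h0 : boundaryIntegral p u f (circleArc c 0 0) = 0 :=
    boundaryIntegral_finite (by simp [circleArc])
  have hr : (range fun x => (c x : S)) = circleArc c 0 (2 * Real.pi) := by
    apply Subset.antisymm
    · rintro _ ⟨x, rfl⟩
      obtain ⟨r, hr, rfl⟩ := Circle.exists_exp_eq x
      exact ⟨r, hr, rfl⟩
    · rintro _ ⟨r, -, rfl⟩
      exact ⟨_, rfl⟩
  simp only [d, h0] at h
  rw [hr]
  linear_combination h

end Circle

/-! ### Degrees of maps of the circle -/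

section Degree

theorem circleDegree_mul (f g : C(Circle, Circle)) :
    circleDegree (f * g) = circleDegree f + circleDegree g := by
  obtain ⟨k, θ, hθ, hk⟩ := circleLift_degree_exists f
  obtain ⟨m, η, hη, hm⟩ := circleLift_degree_exists g
  have hk0 := hk 0
  have hm0 := hm 0
  rw [zero_add] at hk0 hm0
  rw [circleDegree_eq hθ hk0, circleDegree_eq hη hm0]
  refine circleDegree_eq (θ := θ + η) (fun t => ?_) ?_
  · simp [hθ, hη, Circle.exp_add]
  · simp only [ContinuousMap.add_apply, hk0, hm0]
    push_cast
    ring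

theorem strictMono_of_eventually_strictMonoOn {θ : ℝ → ℝ} (hc : Continuous θ)
    (h : ∀ t, ∃ N ∈ 𝓝 t, StrictMonoOn θ N) : StrictMono θ := by
  intro a b hab
  -- a maximum on `[a, b]` can only be attained at `b`
  have key : ∀ x ∈ Icc a b, IsMaxOn θ (Icc a b) x → x = b := by
    intro x hx hmax
    by_contra hne
    have hxb : x < b := lt_of_le_of_ne hx.2 hne
    obtain ⟨N, hN, hmono⟩ := h x
    obtain ⟨y, hyN, hy⟩ : ∃ y ∈ N, y ∈ Ioo x b := by
      have h1 : N ∩ Ioo x b ∈ 𝓝[>] x :=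
        Filter.inter_mem (mem_nhdsWithin_of_mem_nhds hN) (Ioo_mem_nhdsGT hxb)
      obtain ⟨y, hy⟩ := Filter.nonempty_of_mem h1
      exact ⟨y, hy.1, hy.2⟩
    exact (hmono (mem_of_mem_nhds hN) hyN hy.1).not_ge (hmax ⟨hx.1.trans hy.1.le, hy.2.le⟩)
  obtain ⟨x, hx, hmax⟩ := isCompact_Icc.exists_isMaxOn (nonempty_Icc.2 hab.le) hc.continuousOn
  obtain rfl := key x hx hmax
  refine lt_of_le_of_ne (hmax (left_mem_Icc.2 hab.le)) fun heq => hab.ne ?_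
  refine key a (left_mem_Icc.2 hab.le) fun y hy => ?_
  change θ y ≤ θ a
  rw [heq]
  exact hmax hy

/-- Precomposition with an injective map of the circle with increasing lift preserves degrees. -/
theorem circleDegree_comp_of_strictMono (g : C(Circle, Circle)) {h : C(Circle, Circle)}
    (hinj : Function.Injective h) {θ : C(ℝ, ℝ)} (hθ : ∀ t, h (Circle.exp t) = Circle.exp (θ t))
    (hmono : StrictMono θ) : circleDegree (g.comp h) = circleDegree g := by
  have hpi := Real.two_pi_pos
  -- the lift increases by exactly one period
  have hone : θ (2 * Real.pi) = θ 0 + 2 * Real.pi := by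
    obtain ⟨k, hk⟩ : ∃ k : ℤ, θ (2 * Real.pi) = θ 0 + k * (2 * Real.pi) := by
      rw [← Circle.exp_eq_exp, ← hθ, ← hθ, ← zero_add (2 * Real.pi), Circle.exp_add_two_pi]
    have hlt : θ 0 < θ (2 * Real.pi) := hmono hpi
    have hk0 : 0 < k := by
      by_contra! hneg
      have : (k : ℝ) ≤ 0 := by exact_mod_cast hneg
      nlinarith
    have hk1 : k ≤ 1 := by
      by_contra! hk2
      have hk2' : (2 : ℝ) ≤ k := by exact_mod_cast hk2
      have hmem : θ 0 + 2 * Real.pi ∈ Ioo (θ 0) (θ (2 * Real.pi)) := ⟨by linarith, by nlinarith⟩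
      obtain ⟨t, ht, hteq⟩ := intermediate_value_Ioo hpi.le θ.continuous.continuousOn hmem
      have h1 : h (Circle.exp t) = h (Circle.exp 0) := by
        rw [hθ, hθ, hteq, Circle.exp_add_two_pi]
      obtain ⟨m, hm⟩ := Circle.exp_eq_exp.1 (hinj h1)
      rw [zero_add] at hm
      have hm0 : (0 : ℝ) < m := by
        by_contra! hneg
        nlinarith [ht.1]
      have hm1 : (m : ℝ) < 1 := by
        by_contra! hneg
        nlinarith [ht.2]
      have h2 : 0 < m := by exact_mod_cast hm0
      have h3 : m < 1 := by exact_mod_cast hm1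
      omega
    have : k = 1 := by omega
    rw [hk, this]
    simp
  obtain ⟨m, η, hη, hm⟩ := circleLift_degree_exists g
  have hm0 := hm 0
  rw [zero_add] at hm0
  rw [circleDegree_eq hη hm0]
  refine circleDegree_eq (θ := η.comp θ) (fun t => ?_) ?_
  · simp [hθ, hη]
  · simp [hone, hm]

end Degree

/-! ### Degrees on the oriented boundary circles -/

section BoundaryDegree

variable {S : Type*} [TopologicalSpace S] [ChartedSpace ClosedHalfPlane S]

/-- Two oriented parametrizations of the same boundary circle give the same degree: they differ
by an increasing reparametrization of the circle. -/
theorem circleDegree_comp_orientedBoundaryCircle [T2Space S]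
    {R : ConnectedComponents (surfaceBoundary S)} {c₁ c₂ : C(Circle, surfaceBoundary S)}
    (hc₁ : IsOrientedBoundaryCircle R c₁) (hc₂ : IsOrientedBoundaryCircle R c₂)
    (g : C(surfaceBoundary S, Circle)) :
    circleDegree (g.comp c₁) = circleDegree (g.comp c₂) := by
  have hex : ∀ z, ∃ w, c₁ w = c₂ z := fun z => by
    rw [← mem_range, hc₁.range_eq, ← hc₂.range_eq]
    exact mem_range_self z
  choose φ hφ using hex
  have hemb := c₁.continuous.isClosedEmbedding hc₁.injective
  have hφc : Continuous φ := by
    rw [hemb.isInducing.continuous_iff]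
    have : (c₁ : Circle → surfaceBoundary S) ∘ φ = c₂ := funext hφ
    rw [this]
    exact c₂.continuous
  have hinj : Function.Injective φ := fun z w hzw => hc₂.injective (by rw [← hφ, ← hφ, hzw])
  obtain ⟨θ, hθ⟩ := circleLift_exists ⟨φ, hφc⟩
  have hθ' : ∀ t, c₁ (Circle.exp (θ t)) = c₂ (Circle.exp t) := fun t => by
    rw [← hθ]
    exact hφ _
  have hmono : StrictMono θ := by
    refine strictMono_of_eventually_strictMonoOn θ.continuous fun t => ?_
    have hsrc := mem_chart_source ClosedHalfPlane (c₂ (Circle.exp t) : S)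
    obtain ⟨N₂, hN₂, hmono₂⟩ := hc₂.positive _ (chart_mem_atlas _ _) t hsrc
    rw [← hθ'] at hsrc
    obtain ⟨N₁, hN₁, hmono₁⟩ := hc₁.positive _ (chart_mem_atlas _ _) (θ t) hsrc
    refine ⟨N₂ ∩ θ ⁻¹' N₁, Filter.inter_mem hN₂ (θ.continuous.continuousAt.preimage_mem_nhds hN₁),
      fun a ha b hb hab => ?_⟩
    have h := hmono₂ ha.1 hb.1 hab
    simp only [← hθ'] at h
    exact (hmono₁.lt_iff_lt ha.2 hb.2).1 h
  have hcomp : g.comp c₂ = (g.comp c₁).comp ⟨φ, hφc⟩ := by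
    ext z
    simp [hφ]
  rw [hcomp, circleDegree_comp_of_strictMono _ hinj hθ hmono]

theorem exists_smooth_partition [IsManifold halfPlaneModel ω S] [CompactSpace S] [T2Space S] :
    ∃ (t : Finset S) (u : t → S → ℂ), (∀ i, SmoothOnSurface (u i)) ∧
      (∀ i, tsupport (u i) ⊆ (coord (i : S)).source) ∧ ∀ x, ∑ i, u i x = 1 := by
  have := isManifold_realHalfPlaneModel (S := S)
  obtain ⟨t, -, ht⟩ := isCompact_univ.elim_nhds_subcover (fun x : S => (coord x).source)
    fun x _ => extChartAt_source_mem_nhds x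
  obtain ⟨ρ, hρ⟩ := SmoothPartitionOfUnity.exists_isSubordinate realHalfPlaneModel
    (isClosed_univ (X := S)) (fun i : t => (coord (i : S)).source)
    (fun i => isOpen_coord_source _) (fun x hx => by
      obtain ⟨i, hi, hxi⟩ := mem_iUnion₂.1 (ht hx)
      exact mem_iUnion.2 ⟨⟨i, hi⟩, hxi⟩)
  refine ⟨t, fun i x => (ρ i x : ℂ), fun i => ?_, fun i => ?_, fun x => ?_⟩
  · exact (Complex.ofRealCLM.contDiff (n := ∞)).contMDiff.comp (ρ i).contMDiff
  · refine Subset.trans (closure_mono fun x hx => ?_) (hρ i)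
    simpa using hx
  · have h := ρ.sum_eq_one (mem_univ x)
    rw [finsum_eq_sum_of_fintype] at h
    rw [← Complex.ofReal_sum, h, Complex.ofReal_one]

/-- The degrees of a map to the circle on the oriented boundary circles add up to zero. -/
theorem sum_circleDegree_boundary_eq_zero [BorderedRiemannSurface S] {κ : Type*} [Fintype κ]
    (R : κ ≃ ConnectedComponents (surfaceBoundary S)) (c : κ → C(Circle, surfaceBoundary S))
    (hc : ∀ k, IsOrientedBoundaryCircle (R k) (c k)) (f : C(S, Circle)) :
    ∑ k, circleDegree ((f.restrict (surfaceBoundary S)).comp (c k)) = 0 := by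
  have hS : BorderedRiemannSurface S := inferInstance
  have := hS.t2Space
  have := hS.compactSpace
  have := hS.isManifold
  have := isManifold_realHalfPlaneModel (S := S)
  -- a smooth function `g` close to `f`
  obtain ⟨g, hg⟩ := exists_contMDiffMap_forall_mem_convex_of_local_const realHalfPlaneModel
    (M := S) (F := ℂ) (t := fun x => Metric.ball (f x : ℂ) 1) (n := ⊤)
    (fun x => convex_ball _ _) (fun x => ⟨f x, by
      have hcont : Continuous fun y => (f y : ℂ) := continuous_subtype_val.comp f.continuous
      have h := hcont.continuousAt (x := x) (Metric.ball_mem_nhds _ one_pos)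
      filter_upwards [h] with y hy
      exact Metric.mem_ball_comm.1 hy⟩)
  have hslit : ∀ x, g x / f x ∈ Complex.slitPlane := fun x => by
    refine Complex.ball_one_subset_slitPlane ?_
    have h := hg x
    rw [Metric.mem_ball, dist_eq_norm] at h ⊢
    have hfx : (f x : ℂ) ≠ 0 := Circle.coe_ne_zero _
    rw [div_sub_one hfx, norm_div, Circle.norm_coe, div_one]
    exact h
  have hg0 : ∀ x, g x ≠ 0 := fun x h0 => by
    have h := hslit x
    rw [h0, zero_div] at h
    simp at h
  have hgs : SmoothOnSurface g := g.contMDiff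
  obtain ⟨t, u, hu, hup, hsum⟩ := exists_smooth_partition (S := S)
  have hcircle : ∀ k, boundaryIntegral (fun i : t => (i : S)) u g (range fun x => (c k x : S)) =
      circleDegree ((f.restrict (surfaceBoundary S)).comp (c k)) * (2 * Real.pi * Complex.I) := by
    intro k
    obtain ⟨m, θ, hθ, hm⟩ := circleLift_degree_exists ((f.restrict (surfaceBoundary S)).comp (c k))
    have hm0 := hm 0
    rw [zero_add] at hm0
    rw [circleDegree_eq hθ hm0]
    have hγ := continuous_circle_param (c k)
    -- a continuous logarithm of `g` along the circle: the argument of `f`, which increases by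
    -- `2πm`, corrected by the logarithm of `g / f`, which is periodic
    set l : ℝ → ℂ := fun r =>
      θ r * Complex.I + Complex.log (g (c k (Circle.exp r)) / f (c k (Circle.exp r)))
    have hl : Continuous l := by
      refine (by fun_prop : Continuous fun r => (θ r * Complex.I : ℂ)).add
        (Continuous.clog ?_ fun r => hslit _)
      exact (hgs.continuous.comp hγ).div
        (continuous_subtype_val.comp (f.continuous.comp hγ)) fun r => Circle.coe_ne_zero _
    rw [boundaryIntegral_range_circle hu hgs hg0 hup hsum (hc k) hl fun r => ?_]
    · have h2 : Circle.exp (2 * Real.pi) = Circle.exp 0 := by simp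
      simp only [l, h2, hm0]
      push_cast
      ring
    · have h1 : Complex.exp (θ r * Complex.I) = f (c k (Circle.exp r)) := by
        rw [← Circle.coe_exp, ← hθ]
        rfl
      rw [Complex.exp_add, h1, Complex.exp_log (Complex.slitPlane_ne_zero (hslit _)),
        mul_div_cancel₀ _ (Circle.coe_ne_zero _)]
  have hmem : ∀ k x, (x : S) ∈ (range fun z => (c k z : S)) ↔ ∃ y : surfaceBoundary S,
      ConnectedComponents.mk y = R k ∧ (y : S) = x := fun k x => by
    have h := hc k |>.range_eq
    constructor
    · rintro ⟨z, rfl⟩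
      exact ⟨c k z, by
        have : c k z ∈ range (c k) := mem_range_self z
        rwa [h] at this, rfl⟩
    · rintro ⟨y, hy, rfl⟩
      obtain ⟨z, hz⟩ : y ∈ range (c k) := by rw [h]; exact hy
      exact ⟨z, by rw [← hz]⟩
  have hunion : (⋃ k, range fun z => (c k z : S)) = surfaceBoundary S := by
    ext x
    simp only [mem_iUnion, hmem]
    constructor
    · rintro ⟨k, y, -, rfl⟩
      exact y.2
    · exact fun hx => ⟨R.symm (ConnectedComponents.mk ⟨x, hx⟩), ⟨x, hx⟩, by simp, rfl⟩
  have hdisj : Pairwise (Function.onFun Disjoint fun k => range fun z => (c k z : S)) := by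
    intro k k' hkk'
    refine disjoint_left.2 fun x hx hx' => hkk' ?_
    obtain ⟨y, hy, rfl⟩ := (hmem k x).1 hx
    obtain ⟨y', hy', hyy'⟩ := (hmem k' _).1 hx'
    obtain rfl := Subtype.ext hyy'
    exact R.injective (hy.symm.trans hy')
  have hclosed : ∀ k, IsClosed (range fun z => (c k z : S)) := fun k =>
    (isCompact_range (continuous_subtype_val.comp (c k).continuous)).isClosed
  have h := boundaryIntegral_surfaceBoundary hu hgs hg0 hup hsum
  rw [← hunion, boundaryIntegral_iUnion hu hgs hg0 hup hclosed hdisj] at h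
  simp only [hcircle] at h
  rw [← Finset.sum_mul] at h
  have h2 : (2 * Real.pi * Complex.I : ℂ) ≠ 0 := Complex.two_pi_I_ne_zero
  exact_mod_cast (mul_eq_zero.1 h).resolve_right h2

end BoundaryDegree

/-! ### Change of trivialization -/

section Transition

variable {S : Type*} [TopologicalSpace S] {n : ℕ} {E : S → Type*}
  [TopologicalSpace (TotalSpace (Fin n → ℂ) E)] [∀ x, AddCommGroup (E x)] [∀ x, Module ℂ (E x)]

/-- The transition function `x ↦ (Φ₂)ₓ ∘ (Φ₁)ₓ⁻¹` between two trivializations. -/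
def transitionMatrix (Φ₁ Φ₂ : GlobalTrivialization S n E) (x : S) : Matrix (Fin n) (Fin n) ℂ :=
  LinearMap.toMatrix' ((Φ₁.fiberEquiv x).symm.trans (Φ₂.fiberEquiv x)).toLinearMap

theorem transitionMatrix_mulVec (Φ₁ Φ₂ : GlobalTrivialization S n E) (x : S) (v : E x) :
    transitionMatrix Φ₁ Φ₂ x *ᵥ Φ₁.fiberEquiv x v = Φ₂.fiberEquiv x v := by
  rw [transitionMatrix, LinearMap.toMatrix'_mulVec]
  simp

theorem isUnit_transitionMatrix (Φ₁ Φ₂ : GlobalTrivialization S n E) (x : S) :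
    IsUnit (transitionMatrix Φ₁ Φ₂ x) := by
  rw [transitionMatrix, LinearMap.isUnit_toMatrix'_iff, Module.End.isUnit_iff]
  exact LinearEquiv.bijective _

theorem continuous_transitionMatrix (Φ₁ Φ₂ : GlobalTrivialization S n E) :
    Continuous (transitionMatrix Φ₁ Φ₂) := by
  have hsymm : ∀ x w, Φ₁.toHomeomorph.symm (x, w) = ⟨x, (Φ₁.fiberEquiv x).symm w⟩ := fun x w => by
    rw [Homeomorph.symm_apply_eq, Φ₁.apply_eq, LinearEquiv.apply_symm_apply]
  have hent : ∀ i j, (fun x => transitionMatrix Φ₁ Φ₂ x i j) = fun x =>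
      (Φ₂.toHomeomorph (Φ₁.toHomeomorph.symm (x, Pi.single j 1))).2 i := fun i j => by
    funext x
    rw [hsymm, Φ₂.apply_eq, transitionMatrix, LinearMap.toMatrix'_apply]
    simp
  refine continuous_pi fun i => continuous_pi fun j => ?_
  rw [hent]
  fun_prop

theorem det_transitionMatrix_ne_zero (Φ₁ Φ₂ : GlobalTrivialization S n E) (x : S) :
    (transitionMatrix Φ₁ Φ₂ x).det ≠ 0 :=
  ((Matrix.isUnit_iff_isUnit_det _).1 (isUnit_transitionMatrix Φ₁ Φ₂ x)).ne_zero

/-- The map `S → U(1)` given by `D / D̄`, where `D` is the determinant of the transition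
function between two trivializations. -/
def transitionPhase (Φ₁ Φ₂ : GlobalTrivialization S n E) : C(S, Circle) where
  toFun x := ⟨(transitionMatrix Φ₁ Φ₂ x).det / (starRingEnd ℂ) (transitionMatrix Φ₁ Φ₂ x).det,
    show _ ∈ Metric.sphere (0 : ℂ) 1 by
      rw [mem_sphere_zero_iff_norm, norm_div, RCLike.norm_conj,
        div_self (norm_ne_zero_iff.2 (det_transitionMatrix_ne_zero Φ₁ Φ₂ x))]⟩
  continuous_toFun := by
    refine Continuous.subtype_mk (f := fun x => (transitionMatrix Φ₁ Φ₂ x).det /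
      (starRingEnd ℂ) (transitionMatrix Φ₁ Φ₂ x).det) ?_ _
    have h := (continuous_transitionMatrix Φ₁ Φ₂).matrix_det
    exact h.div (Complex.continuous_conj.comp h) fun x =>
      (map_ne_zero _).2 (det_transitionMatrix_ne_zero Φ₁ Φ₂ x)

theorem TotallyRealSubbundle.detB_image {K : Set S} (ER : TotallyRealSubbundle n E K)
    (Φ₁ Φ₂ : GlobalTrivialization S n E) (x : K) :
    TotallyRealSpace.detB n (ER.image Φ₂ x) =
      transitionPhase Φ₁ Φ₂ x * TotallyRealSpace.detB n (ER.image Φ₁ x) := by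
  obtain ⟨C, hC⟩ := TotallyRealSpace.ofGL_surjective n (ER.image Φ₁ x)
  set A : GL (Fin n) ℂ := (isUnit_transitionMatrix Φ₁ Φ₂ x).unit
  have hA : A.1 = transitionMatrix Φ₁ Φ₂ x := rfl
  have hAC : ER.image Φ₂ x = TotallyRealSpace.ofGL (A * C) := by
    refine Subtype.ext ?_
    have h1 : (ER.fiber x).map ((Φ₁.fiberEquiv x).toLinearMap.restrictScalars ℝ) =
      LinearMap.range (realFrameMap C.1) := (congrArg Subtype.val hC).symm
    have h2 : ((Φ₂.fiberEquiv x).toLinearMap.restrictScalars ℝ) =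
        (A.1.mulVecLin.restrictScalars ℝ).comp
          ((Φ₁.fiberEquiv x).toLinearMap.restrictScalars ℝ) := by
      ext1 v
      exact (transitionMatrix_mulVec Φ₁ Φ₂ x v).symm
    have h3 : realFrameMap (A * C).1 =
        (A.1.mulVecLin.restrictScalars ℝ).comp (realFrameMap C.1) := by
      refine LinearMap.ext fun v => ?_
      simp [realFrameMap_apply, Matrix.mulVec_mulVec]
    change (ER.fiber x).map ((Φ₂.fiberEquiv x).toLinearMap.restrictScalars ℝ) =
      LinearMap.range (realFrameMap (A * C).1)
    rw [h2, Submodule.map_comp, h1, h3, LinearMap.range_comp]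
  apply Circle.ext
  rw [hAC, ← hC, Circle.coe_mul]
  change (TotallyRealSpace.B (TotallyRealSpace.ofGL (A * C))).1.det = _ / _ *
    (TotallyRealSpace.B (TotallyRealSpace.ofGL C)).1.det
  rw [TotallyRealSpace.det_B_ofGL, TotallyRealSpace.det_B_ofGL, Units.val_mul, Matrix.det_mul,
    map_mul, hA, div_mul_div_comm]

end Transition

theorem mainTheorem7 {S : Type*} [TopologicalSpace S] [ChartedSpace ClosedHalfPlane S]
    [BorderedRiemannSurface S] {n : ℕ} {E : S → Type*}
    [TopologicalSpace (TotalSpace (Fin n → ℂ) E)] [∀ x, AddCommGroup (E x)] [∀ x, Module ℂ (E x)]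
    [∀ x, TopologicalSpace (E x)] [FiberBundle (Fin n → ℂ) E] [VectorBundle ℂ (Fin n → ℂ) E]
    (ER : TotallyRealSubbundle n E (surfaceBoundary S))
    {h : ℕ} (R : Fin h ≃ ConnectedComponents (surfaceBoundary S))
    (c₁ c₂ : Fin h → C(Circle, surfaceBoundary S))
    (hc₁ : ∀ i, IsOrientedBoundaryCircle (R i) (c₁ i))
    (hc₂ : ∀ i, IsOrientedBoundaryCircle (R i) (c₂ i))
    (Φ₁ Φ₂ : GlobalTrivialization S n E) :
    ∑ i, maslovIndex (ER.loop Φ₁ (c₁ i)) = ∑ i, maslovIndex (ER.loop Φ₂ (c₂ i)) := by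
  have hS : BorderedRiemannSurface S := inferInstance
  have := hS.t2Space
  have hparam : ∀ i, maslovIndex (ER.loop Φ₁ (c₁ i)) = maslovIndex (ER.loop Φ₁ (c₂ i)) := fun i =>
    circleDegree_comp_orientedBoundaryCircle (hc₁ i) (hc₂ i)
      ((TotallyRealSpace.detB n).comp ⟨ER.image Φ₁, ER.continuous_image Φ₁⟩)
  have htriv : ∀ i, maslovIndex (ER.loop Φ₂ (c₂ i)) =
      circleDegree (((transitionPhase Φ₁ Φ₂).restrict (surfaceBoundary S)).comp (c₂ i)) +
        maslovIndex (ER.loop Φ₁ (c₂ i)) := fun i => by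
    rw [maslovIndex, maslovIndex, ← circleDegree_mul]
    congr 1
    exact ContinuousMap.ext fun z => ER.detB_image Φ₁ Φ₂ (c₂ i z)
  simp only [hparam, htriv, Finset.sum_add_distrib,
    sum_circleDegree_boundary_eq_zero R c₂ hc₂ (transitionPhase Φ₁ Φ₂), zero_add]

end
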